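/- Let $d \ge 2$, let $U \subset \mathbb{R}^d$ be an open subset, and let $\Delta = -\sum_{i=1}^d \partial_i^2$. Let $C_c^\infty(U)$ be the real vector space of real-valued smooth functions with compact support in $U$, and let $H(U) = \{u \in C^\infty(U) \mid \Delta u = 0\}$ be the space of real-valued harmonic functions on $U$, equipped with the subspace topology of $C^\infty(U)$, i.e. the locally convex topology defined by the seminorms $p_{K,m}(u) = \max_{|\alpha| \le m} \sup_{x \in K} |\partial^\alpha u(x)|$ for $K \subset U$ compact and $m \in \mathbb{N}$. Let $H'(U)$ be the space of continuous linear functionals $H(U) \to \mathbb{R}$. **Theorem.** The pairing $B(f,u) = \int_U f(x)u(x)\,dx$ ($f \in C_c^\infty(U)$, $u \in H(U)$) induces a well-defined linear isomorphism $$T_U : C_c^\infty(U)/\Delta C_c^\infty(U) \xrightarrow{\ \cong\ } H'(U), \qquad T_U([f])(u) = \int_U f(x)u(x)\,dx .$$ **Corollary.** Put $C_c^\infty(U)_0 = \{f \in C_c^\infty(U) \mid \int f\,dx = 0\}$ and $H'(U)_0 = \{T \in H'(U) \mid T(1_U) = 0\}$, where $1_U$ is the constant function $1$ on $U$. Then $\Delta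 C_c^\infty(U) \subset C_c^\infty(U)_0$, and $T_U$ restricts to a linear isomorphism $C_c^\infty(U)_0/\Delta C_c^\infty(U) \to H'(U)_0$ (in particular for $d = 2$). -/

import Mathlib

open TopologicalSpace MeasureTheory
open scoped ContDiff Distributions Laplacian

noncomputable section

variable {d : ℕ}

/-- Extension by zero to `ℝ^d` of a function defined on an open set `U`. It is only used to speak
about derivatives at points of `U`, where the values outside the open set `U` are irrelevant. -/
def zeroExtend {U : Opens (EuclideanSpace ℝ (Fin d))} (u : U → ℝ) :
    EuclideanSpace ℝ (Fin d) → ℝ :=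
  Function.extend Subtype.val u 0

theorem zeroExtend_add {U : Opens (EuclideanSpace ℝ (Fin d))} (u v : U → ℝ) :
    zeroExtend (u + v) = zeroExtend u + zeroExtend v := by
  simpa [zeroExtend] using Function.extend_add (Subtype.val : U → _) u v 0 0

theorem zeroExtend_smul {U : Opens (EuclideanSpace ℝ (Fin d))} (c : ℝ) (u : U → ℝ) :
    zeroExtend (c • u) = c • zeroExtend u := by
  simpa [zeroExtend] using Function.extend_smul c (Subtype.val : U → _) u 0

theorem zeroExtend_zero {U : Opens (EuclideanSpace ℝ (Fin d))} :
    zeroExtend (0 : U → ℝ) = 0 := by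
  simpa using zeroExtend_smul (0 : ℝ) (0 : U → ℝ)

theorem zeroExtend_apply {U : Opens (EuclideanSpace ℝ (Fin d))} (u : U → ℝ) (x : U) :
    zeroExtend u x = u x :=
  Subtype.val_injective.extend_apply u 0 x

/-- The linear subspace of all `C^∞` functions inside the space of all functions `U → ℝ`. -/
def smoothSubmodule (U : Opens (EuclideanSpace ℝ (Fin d))) : Submodule ℝ (U → ℝ) where
  carrier := {u | ContDiffOn ℝ ∞ (zeroExtend u) U}
  add_mem' {u v} hu hv := by
    change ContDiffOn ℝ ∞ (zeroExtend (u + v)) U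
    rw [zeroExtend_add]
    exact ContDiffOn.add hu hv
  zero_mem' := by
    change ContDiffOn ℝ ∞ (zeroExtend (0 : U → ℝ)) U
    rw [zeroExtend_zero]
    exact contDiffOn_const
  smul_mem' c u hu := by
    change ContDiffOn ℝ ∞ (zeroExtend (c • u)) U
    rw [zeroExtend_smul]
    exact ContDiffOn.const_smul c hu

/-- The space `C^∞(U)` of smooth functions `U → ℝ`. It is a new type, so that it does not inherit
the topology of pointwise convergence from `U → ℝ`. -/
def SmoothFun (U : Opens (EuclideanSpace ℝ (Fin d))) : Type :=
  smoothSubmodule U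

namespace SmoothFun

instance (U : Opens (EuclideanSpace ℝ (Fin d))) : AddCommGroup (SmoothFun U) :=
  inferInstanceAs (AddCommGroup (smoothSubmodule U))

instance (U : Opens (EuclideanSpace ℝ (Fin d))) : Module ℝ (SmoothFun U) :=
  inferInstanceAs (Module ℝ (smoothSubmodule U))

/-- The underlying function `U → ℝ`, extended by zero to `ℝ^d`. -/
def ext {U : Opens (EuclideanSpace ℝ (Fin d))} (u : SmoothFun U) : EuclideanSpace ℝ (Fin d) → ℝ :=
  zeroExtend u.1

theorem contDiffAt {U : Opens (EuclideanSpace ℝ (Fin d))} (u : SmoothFun U)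
    {x : EuclideanSpace ℝ (Fin d)} (hx : x ∈ U) : ContDiffAt ℝ ∞ u.ext x :=
  ContDiffOn.contDiffAt u.2 (U.isOpen.mem_nhds hx)

theorem ext_add {U : Opens (EuclideanSpace ℝ (Fin d))} (u v : SmoothFun U) :
    (u + v).ext = u.ext + v.ext :=
  zeroExtend_add u.1 v.1

theorem ext_smul {U : Opens (EuclideanSpace ℝ (Fin d))} (c : ℝ) (u : SmoothFun U) :
    (c • u).ext = c • u.ext :=
  zeroExtend_smul c u.1

/-- The iterated partial derivative `∂_{i 0} ⋯ ∂_{i (k - 1)} u` at the point `x`. As `i` runs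
through all tuples of length `k`, these are all `∂^α u` with `|α| = k`. -/
def partialDeriv {U : Opens (EuclideanSpace ℝ (Fin d))} {k : ℕ} (i : Fin k → Fin d)
    (u : SmoothFun U) (x : U) : ℝ :=
  iteratedFDeriv ℝ k u.ext x (fun j => EuclideanSpace.single (i j) 1)

theorem partialDeriv_add {U : Opens (EuclideanSpace ℝ (Fin d))} {k : ℕ} (i : Fin k → Fin d)
    (u v : SmoothFun U) (x : U) :
    partialDeriv i (u + v) x = partialDeriv i u x + partialDeriv i v x := by
  have hk : ((k : ℕ) : ℕ∞ω) ≤ ∞ := mod_cast le_top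
  simp only [partialDeriv, ext_add]
  rw [iteratedFDeriv_add_apply ((u.contDiffAt x.2).of_le hk) ((v.contDiffAt x.2).of_le hk)]
  rfl

theorem partialDeriv_smul {U : Opens (EuclideanSpace ℝ (Fin d))} {k : ℕ} (i : Fin k → Fin d)
    (c : ℝ) (u : SmoothFun U) (x : U) :
    partialDeriv i (c • u) x = c * partialDeriv i u x := by
  have hk : ((k : ℕ) : ℕ∞ω) ≤ ∞ := mod_cast le_top
  simp only [partialDeriv, ext_smul]
  rw [iteratedFDeriv_const_smul_apply ((u.contDiffAt x.2).of_le hk)]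
  rfl

theorem continuous_partialDeriv {U : Opens (EuclideanSpace ℝ (Fin d))} {k : ℕ}
    (i : Fin k → Fin d) (u : SmoothFun U) : Continuous (partialDeriv i u) := by
  have hk : ((k : ℕ) : ℕ∞ω) ≤ ∞ := mod_cast le_top
  rw [continuous_iff_continuousAt]
  intro x
  have h : ContinuousAt (iteratedFDeriv ℝ k u.ext) x :=
    ((u.contDiffAt x.2).of_le hk).continuousAt_iteratedFDeriv le_rfl
  have h' : ContinuousAt (fun y : U => iteratedFDeriv ℝ k u.ext y) x :=
    ContinuousAt.comp (f := (Subtype.val : U → _)) h continuous_subtype_val.continuousAt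
  exact ((ContinuousMultilinearMap.apply ℝ _ ℝ _).continuous.continuousAt).comp h'

theorem bddAbove_partialDeriv {U : Opens (EuclideanSpace ℝ (Fin d))} (K : Compacts U) {k : ℕ}
    (i : Fin k → Fin d) (u : SmoothFun U) :
    BddAbove (Set.range fun x : K => |partialDeriv i u x|) := by
  have := K.isCompact.bddAbove_image (continuous_partialDeriv i u).abs.continuousOn
  rwa [Set.image_eq_range] at this

/-- The seminorm `u ↦ sup_{x ∈ K} |∂_{i 0} ⋯ ∂_{i (k - 1)} u (x)|` (it is `0` if `K = ∅`). -/
def partialSeminorm {U : Opens (EuclideanSpace ℝ (Fin d))} (K : Compacts U) {k : ℕ}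
    (i : Fin k → Fin d) : Seminorm ℝ (SmoothFun U) :=
  Seminorm.of (fun u => ⨆ x : K, |partialDeriv i u x|)
    (fun u v => by
      refine Real.iSup_le (fun x => ?_) (add_nonneg (Real.iSup_nonneg fun _ => abs_nonneg _)
        (Real.iSup_nonneg fun _ => abs_nonneg _))
      rw [partialDeriv_add]
      exact (abs_add_le _ _).trans (add_le_add (le_ciSup (bddAbove_partialDeriv K i u) x)
        (le_ciSup (bddAbove_partialDeriv K i v) x)))
    (fun c u => by
      simp only [partialDeriv_smul, abs_mul, Real.norm_eq_abs]
      exact (Real.mul_iSup_of_nonneg (abs_nonneg c) _).symm)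

/-- The seminorm `p_{K,m}(u) = max_{|α| ≤ m} sup_{x ∈ K} |∂^α u (x)|`. -/
def smoothSeminorm {U : Opens (EuclideanSpace ℝ (Fin d))} (K : Compacts U) (m : ℕ) :
    Seminorm ℝ (SmoothFun U) :=
  (Finset.range (m + 1)).sup fun k =>
    Finset.univ.sup fun i : Fin k → Fin d => partialSeminorm K i

/-- The family of all seminorms `p_{K,m}`, for `K ⊆ U` compact and `m ∈ ℕ`. -/
def smoothSeminormFamily (U : Opens (EuclideanSpace ℝ (Fin d))) :
    SeminormFamily ℝ (SmoothFun U) (Compacts U × ℕ) :=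
  fun p => smoothSeminorm p.1 p.2

/-- The `C^∞` topology: the locally convex topology defined by the seminorms `p_{K,m}`. -/
instance (U : Opens (EuclideanSpace ℝ (Fin d))) : TopologicalSpace (SmoothFun U) :=
  (smoothSeminormFamily U).moduleFilterBasis.topology

theorem withSeminorms (U : Opens (EuclideanSpace ℝ (Fin d))) :
    WithSeminorms (smoothSeminormFamily U) :=
  ⟨rfl⟩

end SmoothFun

/-- The space `H(U)` of harmonic functions on `U`, a linear subspace of `C^∞(U)`; as a topological
space it carries the subspace topology. -/
def harmonicSubmodule (U : Opens (EuclideanSpace ℝ (Fin d))) : Submodule ℝ (SmoothFun U) where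
  carrier := {u | ∀ x ∈ U, (Δ u.ext) x = (0 : ℝ)}
  add_mem' {u v} hu hv x hx := by
    have h2 : (2 : ℕ∞ω) ≤ ∞ := WithTop.coe_le_coe.2 (le_top : (2 : ℕ∞) ≤ ⊤)
    rw [SmoothFun.ext_add, ContDiffAt.laplacian_add ((u.contDiffAt hx).of_le h2)
      ((v.contDiffAt hx).of_le h2), hu x hx, hv x hx, add_zero]
  zero_mem' x _ := by
    have h : (0 : SmoothFun U).ext = fun _ => (0 : ℝ) := zeroExtend_zero
    rw [h, InnerProductSpace.laplacian_const]
    rfl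
  smul_mem' c u hu x hx := by
    have h2 : (2 : ℕ∞ω) ≤ ∞ := WithTop.coe_le_coe.2 (le_top : (2 : ℕ∞) ≤ ⊤)
    rw [SmoothFun.ext_smul, InnerProductSpace.laplacian_smul c ((u.contDiffAt hx).of_le h2),
      hu x hx, smul_zero]

/-- The topological dual `H'(U)` of `H(U)`. -/
abbrev HarmonicDual (U : Opens (EuclideanSpace ℝ (Fin d))) : Type :=
  harmonicSubmodule U →L[ℝ] ℝ

theorem zeroExtend_one_eventuallyEq {U : Opens (EuclideanSpace ℝ (Fin d))}
    {x : EuclideanSpace ℝ (Fin d)} (hx : x ∈ U) :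
    zeroExtend (1 : U → ℝ) =ᶠ[nhds x] fun _ => (1 : ℝ) := by
  filter_upwards [U.isOpen.mem_nhds hx] with y hy
  exact zeroExtend_apply (1 : U → ℝ) ⟨y, hy⟩

/-- The constant function `1_U`, as an element of `H(U)`. -/
def harmonicOne (U : Opens (EuclideanSpace ℝ (Fin d))) : harmonicSubmodule U :=
  ⟨⟨(1 : U → ℝ), fun _ hx =>
      (contDiffAt_const.congr_of_eventuallyEq (zeroExtend_one_eventuallyEq hx)).contDiffWithinAt⟩,
    fun x hx => by
      change (Δ (zeroExtend (1 : U → ℝ))) x = 0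
      rw [(InnerProductSpace.laplacian_congr_nhds (zeroExtend_one_eventuallyEq hx)).eq_of_nhds,
        InnerProductSpace.laplacian_const]
      rfl⟩

/-- The subspace `H'(U)_0 = {T ∈ H'(U) | T(1_U) = 0}`. -/
def harmonicDualZero (U : Opens (EuclideanSpace ℝ (Fin d))) : Submodule ℝ (HarmonicDual U) where
  carrier := {T | T (harmonicOne U) = 0}
  add_mem' {S T} hS hT := by
    change S (harmonicOne U) + T (harmonicOne U) = 0
    rw [show S (harmonicOne U) = 0 from hS, show T (harmonicOne U) = 0 from hT, add_zero]
  zero_mem' := rfl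
  smul_mem' c T hT := by
    change c • T (harmonicOne U) = 0
    rw [show T (harmonicOne U) = 0 from hT, smul_zero]

/-- The operator `Δ = -∑ i, ∂_i²` on the space `C_c^∞(U)` of real test functions. -/
def testLaplacian (U : Opens (EuclideanSpace ℝ (Fin d))) : 𝓓(U, ℝ) →ₗ[ℝ] 𝓓(U, ℝ) :=
  -(LineDeriv.laplacianCLM ℝ (EuclideanSpace ℝ (Fin d)) 𝓓(U, ℝ) : 𝓓(U, ℝ) →ₗ[ℝ] 𝓓(U, ℝ))

/-- The subspace `Δ C_c^∞(U)` of `C_c^∞(U)`. -/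
def laplacianRange (U : Opens (EuclideanSpace ℝ (Fin d))) : Submodule ℝ 𝓓(U, ℝ) :=
  LinearMap.range (testLaplacian U)

/-- The subspace `C_c^∞(U)_0 = {f ∈ C_c^∞(U) | ∫ f = 0}`. -/
def meanZeroTest (U : Opens (EuclideanSpace ℝ (Fin d))) : Submodule ℝ 𝓓(U, ℝ) where
  carrier := {f | ∫ x, f x = 0}
  add_mem' {f g} hf hg := by
    change ∫ x, (f x + g x) = 0
    rw [integral_add (f.continuous.integrable_of_hasCompactSupport f.hasCompactSupport)
      (g.continuous.integrable_of_hasCompactSupport g.hasCompactSupport),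
      show ∫ x, f x = 0 from hf, show ∫ x, g x = 0 from hg, add_zero]
  zero_mem' := by
    change ∫ _ : EuclideanSpace ℝ (Fin d), (0 : ℝ) = 0
    simp
  smul_mem' c f hf := by
    change ∫ x, c * f x = 0
    rw [integral_const_mul, show ∫ x, f x = 0 from hf, mul_zero]

/-- The pairing `B(f, u) = ∫_U f(x) u(x) dx` of `f ∈ C_c^∞(U)` and `u ∈ H(U)`. -/
def harmonicPairing {U : Opens (EuclideanSpace ℝ (Fin d))} (f : 𝓓(U, ℝ))
    (u : harmonicSubmodule U) : ℝ :=
  ∫ x in (U : Set (EuclideanSpace ℝ (Fin d))), f x * (u : SmoothFun U).ext x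

end

/-! In these comments Δ is ∑ ∂_i²; `testLaplacian` is its negative, which has the same range. Write
E for `fundSol`. Everything reduces to showing that f ↦ B(f, ·) is onto H'(U) with kernel Δ
C_c^∞(U). Both halves rest on the distributional identity ΔE = c δ₀ with c > 0
(`exists_integral_fundSol_mul_laplacian`).

Kernel. Green's formula gives B(Δφ, u) = 0. Conversely, let f be orthogonal to all harmonic
functions on U. The potential E * f is smooth and Δ(E * f) = c f, so it remains to see that E * f
has compact support in U. For x₀ ∉ U and x near x₀, expand E(x₀ + t(x - x₀) - y) in powers of t and
put t = 1: each coefficient is harmonic in y on U, hence killed by f, and E * f vanishes near x₀.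
For large |x|, expand E(x - ty) in the same way. `integral_mul_fundSol_eq_zero` covers both
expansions; convergence, uniform for y in the support of f, follows from complexifying t and
Cauchy's estimates. Since the argument is run at every point outside U separately, neither unique
continuation nor the topology of U plays a role.

Surjectivity. A continuous T is bounded by finitely many derivatives on a compact K, so by
Hahn–Banach it is T u = S(jet of u along K), with S continuous on a finite power of C(K). Removing
the singularity of E by a cutoff and applying Δ gives a test function ρ with u = (χu) * ρ near K for
every harmonic u (`exists_cutoff_reproducing`). Moving S under the integral represents T by the
continuous density t ↦ χ(t) S(jet of ρ(· - t)); the same reproducing formula and Fubini make the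
density smooth.

The corollary follows from B(f, 1) = ∫ f: the mean-zero test functions are the preimage of H'(U)_0.
-/

/-! ### Directional derivatives -/

section DirDeriv

variable {X : Type*} [NormedAddCommGroup X] [NormedSpace ℝ X]

/-- The derivative of `F` in the direction `v`. -/
noncomputable def dirDeriv (v : X) (F : X → ℝ) : X → ℝ := fun p => fderiv ℝ F p v

theorem ContDiffAt.dirDeriv {F : X → ℝ} {p : X} {m n : ℕ∞ω} (hF : ContDiffAt ℝ n F p)
    (hmn : m + 1 ≤ n) (v : X) : ContDiffAt ℝ m (dirDeriv v F) p :=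
  (hF.fderiv_right hmn).clm_apply contDiffAt_const

theorem Filter.EventuallyEq.dirDeriv {F G : X → ℝ} {p : X} (h : F =ᶠ[nhds p] G) (v : X) :
    dirDeriv v F =ᶠ[nhds p] dirDeriv v G := by
  filter_upwards [h.eventuallyEq_nhds] with q hq
  simp only [_root_.dirDeriv, hq.fderiv_eq]

theorem dirDeriv_dirDeriv_comm {F : X → ℝ} {p : X} (hF : ContDiffAt ℝ 2 F p) (v w : X) :
    dirDeriv v (dirDeriv w F) p = dirDeriv w (dirDeriv v F) p := by
  have hd : DifferentiableAt ℝ (fderiv ℝ F) p :=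
    (hF.fderiv_right (m := 1) (by norm_num)).differentiableAt (by norm_num)
  have key : ∀ a b : X, dirDeriv a (dirDeriv b F) p = fderiv ℝ (fderiv ℝ F) p a b := fun a b => by
    unfold dirDeriv
    rw [fderiv_clm_apply hd (differentiableAt_const b)]
    simp
  rw [key, key]
  exact (hF.isSymmSndFDerivAt (by simp)) v w

theorem dirDeriv_fun_sum {ι : Type*} (s : Finset ι) {F : ι → X → ℝ} {p : X}
    (hF : ∀ i ∈ s, DifferentiableAt ℝ (F i) p) (v : X) :
    dirDeriv v (fun q => ∑ i ∈ s, F i q) p = ∑ i ∈ s, dirDeriv v (F i) p := by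
  unfold dirDeriv
  rw [fderiv_fun_sum hF]
  simp

end DirDeriv

/-! ### The Laplacian: affine substitutions, Green's formula, radial functions -/

section Laplacian

variable {V : Type*} [NormedAddCommGroup V] [InnerProductSpace ℝ V] [FiniteDimensional ℝ V]

theorem laplacian_eq_sum_dirDeriv {ι : Type*} [Fintype ι] (b : OrthonormalBasis ι ℝ V)
    {f : V → ℝ} {x : V} (hf : ContDiffAt ℝ 2 f x) :
    (Δ f) x = ∑ i, dirDeriv (b i) (dirDeriv (b i) f) x := by
  rw [InnerProductSpace.laplacian_eq_iteratedFDeriv_orthonormalBasis f b]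
  refine Finset.sum_congr rfl fun i _ => ?_
  have hd : DifferentiableAt ℝ (fderiv ℝ f) x :=
    (hf.fderiv_right (m := 1) (by norm_num)).differentiableAt (by norm_num)
  unfold dirDeriv
  rw [iteratedFDeriv_two_apply, fderiv_clm_apply hd (differentiableAt_const _)]
  simp

theorem ContDiffAt.laplacian {f : V → ℝ} {x : V} (hf : ContDiffAt ℝ ∞ f x) :
    ContDiffAt ℝ ∞ (Δ f) x := by
  have h2 : (2 : ℕ∞ω) ≤ ∞ := WithTop.coe_le_coe.2 (le_top : (2 : ℕ∞) ≤ ⊤)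
  have hev : (Δ f) =ᶠ[nhds x] fun y => ∑ i, _root_.dirDeriv (stdOrthonormalBasis ℝ V i)
      (_root_.dirDeriv (stdOrthonormalBasis ℝ V i) f) y := by
    filter_upwards [(hf.of_le h2).eventually (by simp)] with y hy
    exact laplacian_eq_sum_dirDeriv _ hy
  refine ContDiffAt.congr_of_eventuallyEq ?_ hev
  exact ContDiffAt.sum fun i _ => (hf.dirDeriv (m := ∞) (by simp) _).dirDeriv (by simp) _

theorem ContDiff.laplacian {f : V → ℝ} (hf : ContDiff ℝ ∞ f) : ContDiff ℝ ∞ (Δ f) :=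
  contDiff_iff_contDiffAt.2 fun _ => hf.contDiffAt.laplacian

theorem tsupport_laplacian_subset (f : V → ℝ) : tsupport (Δ f) ⊆ tsupport f := by
  refine closure_minimal (fun x hx => ?_) (isClosed_tsupport f)
  by_contra h
  have h0 : f =ᶠ[nhds x] fun _ => (0 : ℝ) := notMem_tsupport_iff_eventuallyEq.1 h
  refine hx ?_
  rw [(InnerProductSpace.laplacian_congr_nhds h0).eq_of_nhds, InnerProductSpace.laplacian_const]
  rfl

theorem HasCompactSupport.laplacian {f : V → ℝ} (hf : HasCompactSupport f) :
    HasCompactSupport (Δ f) :=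
  hf.of_isClosed_subset (isClosed_tsupport _) (tsupport_laplacian_subset f)

theorem laplacian_comp_add_smul (f : V → ℝ) (a : V) (b : ℝ) {x : V}
    (hf : ContDiffAt ℝ 2 f (a + b • x)) :
    (Δ fun y => f (a + b • y)) x = b ^ 2 * (Δ f) (a + b • x) := by
  have hA : ContDiff ℝ 2 fun y : V => a + b • y := by fun_prop
  have key : ∀ (g : V → ℝ) (v y : V), DifferentiableAt ℝ g (a + b • y) →
      dirDeriv v (fun z => g (a + b • z)) y = b * dirDeriv v g (a + b • y) := by
    intro g v y hg
    have h1 : HasFDerivAt (fun z : V => a + b • z) (b • ContinuousLinearMap.id ℝ V) y :=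
      ((hasFDerivAt_id y).const_smul b).const_add a
    have := (hg.hasFDerivAt.comp y h1).fderiv
    unfold dirDeriv
    rw [show (fun z => g (a + b • z)) = g ∘ fun z => a + b • z from rfl, this]
    simp
  have hc : ContDiffAt ℝ 2 (fun y => f (a + b • y)) x := hf.comp x hA.contDiffAt
  rw [laplacian_eq_sum_dirDeriv (stdOrthonormalBasis ℝ V) hf,
    laplacian_eq_sum_dirDeriv (stdOrthonormalBasis ℝ V) hc, Finset.mul_sum]
  refine Finset.sum_congr rfl fun i _ => ?_
  have hev : dirDeriv (stdOrthonormalBasis ℝ V i) (fun y => f (a + b • y)) =ᶠ[nhds x]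
      fun y => b * dirDeriv (stdOrthonormalBasis ℝ V i) f (a + b • y) := by
    filter_upwards [hA.continuous.continuousAt.eventually (hf.eventually (by simp))] with y hy
    exact key f _ y (hy.differentiableAt (by norm_num))
  have hd : DifferentiableAt ℝ (dirDeriv (stdOrthonormalBasis ℝ V i) f) (a + b • x) :=
    (hf.dirDeriv (m := 1) (by norm_num) _).differentiableAt (by norm_num)
  rw [(hev.dirDeriv _).eq_of_nhds]
  have hd' : DifferentiableAt ℝ
      (fun y => dirDeriv (stdOrthonormalBasis ℝ V i) f (a + b • y)) x :=
    DifferentiableAt.comp x (f := fun y => a + b • y) hd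
      (hA.contDiffAt.differentiableAt (by norm_num))
  rw [show dirDeriv (stdOrthonormalBasis ℝ V i)
      (fun y => b * dirDeriv (stdOrthonormalBasis ℝ V i) f (a + b • y)) x
      = b * dirDeriv (stdOrthonormalBasis ℝ V i)
        (fun y => dirDeriv (stdOrthonormalBasis ℝ V i) f (a + b • y)) x by
    simp only [dirDeriv] at hd' ⊢; rw [fderiv_const_mul hd']; simp, key _ _ _ hd]
  ring

theorem laplacian_comp_sub_left (f : V → ℝ) (a : V) {x : V} (hf : ContDiffAt ℝ 2 f (a - x)) :
    (Δ fun y => f (a - y)) x = (Δ f) (a - x) := by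
  have := laplacian_comp_add_smul f a (-1) (x := x) (by simpa [← sub_eq_add_neg] using hf)
  simpa [← sub_eq_add_neg] using this

/-- Green's formula without boundary terms. -/
theorem integral_mul_laplacian [MeasurableSpace V] [BorelSpace V] {f g : V → ℝ}
    (hf : ContDiff ℝ 2 f) (hg : ContDiff ℝ 2 g) (hgc : HasCompactSupport g) :
    ∫ x, f x * (Δ g) x = ∫ x, (Δ f) x * g x := by
  let b := stdOrthonormalBasis ℝ V
  have d1 : ∀ {h : V → ℝ} (v : V), ContDiff ℝ 2 h → ContDiff ℝ 1 (dirDeriv v h) := fun v hh =>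
    contDiff_iff_contDiffAt.2 fun x => hh.contDiffAt.dirDeriv (by norm_num) v
  have d0 : ∀ {h : V → ℝ} (v : V), ContDiff ℝ 1 h → Continuous (dirDeriv v h) := fun v hh =>
    (contDiff_iff_contDiffAt.2 fun x =>
      hh.contDiffAt.dirDeriv (m := 0) (by norm_num) v).continuous
  have c1 : ∀ {h : V → ℝ} (v : V), HasCompactSupport h → HasCompactSupport (dirDeriv v h) :=
    fun v hh => hh.fderiv_apply ℝ v
  have parts : ∀ {u w : V → ℝ} (v : V), ContDiff ℝ 1 u → ContDiff ℝ 1 w →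
      HasCompactSupport u ∨ HasCompactSupport w →
      ∫ x, u x * dirDeriv v w x = - ∫ x, dirDeriv v u x * w x := by
    intro u w v hu hw hc
    have int : ∀ {p q : V → ℝ}, Continuous p → Continuous q →
        HasCompactSupport p ∨ HasCompactSupport q → Integrable fun x => p x * q x := by
      intro p q hp hq h
      refine (hp.mul hq).integrable_of_hasCompactSupport ?_
      rcases h with h | h
      · exact h.mul_right
      · exact h.mul_left
    exact integral_mul_fderiv_eq_neg_fderiv_mul_of_integrable
      (int (d0 v hu) hw.continuous (hc.imp (c1 v) id))
      (int hu.continuous (d0 v hw) (hc.imp id (c1 v)))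
      (int hu.continuous hw.continuous hc)
      (fun x _ => hu.contDiffAt.differentiableAt (by norm_num))
      (fun x _ => hw.contDiffAt.differentiableAt (by norm_num))
  have e1 : ∀ x, f x * (Δ g) x = ∑ i, f x * dirDeriv (b i) (dirDeriv (b i) g) x := fun x => by
    rw [laplacian_eq_sum_dirDeriv b hg.contDiffAt, Finset.mul_sum]
  have e2 : ∀ x, (Δ f) x * g x = ∑ i, dirDeriv (b i) (dirDeriv (b i) f) x * g x := fun x => by
    rw [laplacian_eq_sum_dirDeriv b hf.contDiffAt, Finset.sum_mul]
  simp only [e1, e2]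
  rw [integral_finsetSum, integral_finsetSum]
  · refine Finset.sum_congr rfl fun i _ => ?_
    rw [parts (b i) (hf.of_le (by norm_num)) (d1 _ hg) (Or.inr (c1 _ hgc)),
      parts (u := dirDeriv (b i) f) (w := g) (b i) (d1 _ hf) (hg.of_le (by norm_num))
        (Or.inr hgc) |> neg_eq_iff_eq_neg.2]
  · intro i _
    exact ((d0 _ (d1 _ hf)).mul hg.continuous).integrable_of_hasCompactSupport hgc.mul_left
  · intro i _
    exact (hf.continuous.mul (d0 _ (d1 _ hg))).integrable_of_hasCompactSupport
      (c1 _ (c1 _ hgc)).mul_left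

/-- The Hessian of h(|y|²) is 4h'' y⊗y + 2h' I; take the trace. Working with |y|² rather than |y|
keeps the formula valid at the origin, where the regularised kernels are needed. -/
theorem laplacian_comp_norm_sq {h h' : ℝ → ℝ} {h'' : ℝ} {x : V}
    (hc : ContDiffAt ℝ 2 h (‖x‖ ^ 2))
    (h1 : ∀ᶠ s in nhds (‖x‖ ^ 2), HasDerivAt h (h' s) s)
    (h2 : HasDerivAt h' h'' (‖x‖ ^ 2)) :
    (Δ fun y : V => h (‖y‖ ^ 2)) x =
      4 * ‖x‖ ^ 2 * h'' + 2 * Module.finrank ℝ V * h' (‖x‖ ^ 2) := by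
  let b := stdOrthonormalBasis ℝ V
  have hN : ContDiff ℝ 2 fun y : V => ‖y‖ ^ 2 := contDiff_norm_sq ℝ
  have hev : ∀ v : V, dirDeriv v (fun y : V => h (‖y‖ ^ 2)) =ᶠ[nhds x]
      fun y => h' (‖y‖ ^ 2) * (2 * inner ℝ y v) := by
    intro v
    filter_upwards [hN.continuous.continuousAt.eventually h1] with y hy
    have := (hy.comp_hasFDerivAt y (hasStrictFDerivAt_norm_sq y).hasFDerivAt).fderiv
    unfold dirDeriv
    rw [show (fun y : V => h (‖y‖ ^ 2)) = h ∘ fun y => ‖y‖ ^ 2 from rfl, this]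
    simp
  have hcomp : ContDiffAt ℝ 2 (fun y : V => h (‖y‖ ^ 2)) x := hc.comp x hN.contDiffAt
  rw [laplacian_eq_sum_dirDeriv b hcomp]
  have key : ∀ i, dirDeriv (b i) (dirDeriv (b i) fun y : V => h (‖y‖ ^ 2)) x =
      4 * h'' * inner ℝ x (b i) ^ 2 + 2 * h' (‖x‖ ^ 2) := by
    intro i
    rw [((hev (b i)).dirDeriv (b i)).eq_of_nhds]
    have A := h2.comp_hasFDerivAt x (hasStrictFDerivAt_norm_sq x).hasFDerivAt
    have B : HasFDerivAt (fun y : V => 2 * inner ℝ y (b i)) ((2 : ℝ) • innerSL ℝ (b i)) x := by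
      have := ((innerSL ℝ (b i)).hasFDerivAt (x := x)).const_mul 2
      simpa [real_inner_comm] using this
    have := (A.mul B).fderiv
    unfold dirDeriv
    erw [this]
    simp
    ring
  simp only [key, Finset.sum_add_distrib, ← Finset.mul_sum]
  rw [b.sum_sq_inner_left]
  simp
  ring

end Laplacian

/-! ### Harmonic functions depending on a real parameter -/

section Parameter

variable {V : Type*} [NormedAddCommGroup V] [InnerProductSpace ℝ V] [FiniteDimensional ℝ V]

/-- Written with directional derivatives on the product, the Laplacian in the second variable can be
commuted with differentiation in the parameter. -/
theorem laplacian_slice {ι : Type*} [Fintype ι] (b : OrthonormalBasis ι ℝ V) {G : ℝ × V → ℝ}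
    {p : ℝ × V} (hG : ContDiffAt ℝ 2 G p) :
    (Δ fun y => G (p.1, y)) p.2 = ∑ i, dirDeriv (0, b i) (dirDeriv (0, b i) G) p := by
  have hI : ContDiff ℝ 2 fun y : V => (p.1, y) := by fun_prop
  have key : ∀ (F : ℝ × V → ℝ) (v y : V), DifferentiableAt ℝ F (p.1, y) →
      dirDeriv v (fun z => F (p.1, z)) y = dirDeriv (0, v) F (p.1, y) := by
    intro F v y hF
    have h1 : HasFDerivAt (fun z : V => (p.1, z)) (ContinuousLinearMap.inr ℝ ℝ V) y :=
      hasFDerivAt_prodMk_right p.1 y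
    have := (hF.hasFDerivAt.comp y h1).fderiv
    unfold dirDeriv
    rw [show (fun z => F (p.1, z)) = F ∘ fun z => (p.1, z) from rfl, this]
    simp
  have hcomp : ContDiffAt ℝ 2 (fun y => G (p.1, y)) p.2 :=
    ContDiffAt.comp (g := G) (f := fun y => (p.1, y)) p.2 hG hI.contDiffAt
  rw [laplacian_eq_sum_dirDeriv b hcomp]
  refine Finset.sum_congr rfl fun i _ => ?_
  have hev : dirDeriv (b i) (fun y => G (p.1, y)) =ᶠ[nhds p.2]
      fun y => dirDeriv (0, b i) G (p.1, y) := by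
    filter_upwards [hI.continuous.continuousAt.eventually (hG.eventually (by simp))] with y hy
    exact key G _ y (hy.differentiableAt (by norm_num))
  rw [(hev.dirDeriv _).eq_of_nhds, key _ _ _
    ((hG.dirDeriv (m := 1) (by norm_num) _).differentiableAt (by norm_num))]

/-- Mixed derivatives are symmetric, so the slice Laplacian of the derivative is the derivative of
the slice Laplacian, which vanishes on a whole neighbourhood. This makes the Taylor coefficients in
the parameter harmonic. -/
theorem laplacian_slice_dirDeriv_eq_zero {G : ℝ × V → ℝ} {W : Set (ℝ × V)} (hW : IsOpen W)
    (hG : ∀ p ∈ W, ContDiffAt ℝ ∞ G p) (h0 : ∀ p ∈ W, (Δ fun y => G (p.1, y)) p.2 = 0)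
    (v : ℝ × V) {p : ℝ × V} (hp : p ∈ W) :
    (Δ fun y => dirDeriv v G (p.1, y)) p.2 = 0 := by
  let b := stdOrthonormalBasis ℝ V
  have le : ∀ {k : ℕ}, ((k : ℕ∞) : ℕ∞ω) ≤ ∞ := mod_cast le_top
  have hD : ∀ {F : ℝ × V → ℝ} {q : ℝ × V} (w : ℝ × V), ContDiffAt ℝ ∞ F q →
      ContDiffAt ℝ ∞ (dirDeriv w F) q := fun w h => h.dirDeriv (by simp) w
  have h2 : ∀ {F : ℝ × V → ℝ} {q : ℝ × V}, ContDiffAt ℝ ∞ F q → ContDiffAt ℝ 2 F q :=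
    fun h => h.of_le (le (k := 2))
  rw [laplacian_slice b (h2 (hD v (hG p hp)))]
  have comm : ∀ i, dirDeriv (0, b i) (dirDeriv (0, b i) (dirDeriv v G)) p =
      dirDeriv v (dirDeriv (0, b i) (dirDeriv (0, b i) G)) p := by
    intro i
    have hev : dirDeriv (0, b i) (dirDeriv v G) =ᶠ[nhds p] dirDeriv v (dirDeriv (0, b i) G) := by
      filter_upwards [hW.mem_nhds hp] with q hq
      exact dirDeriv_dirDeriv_comm (h2 (hG q hq)) _ _
    rw [(hev.dirDeriv _).eq_of_nhds, dirDeriv_dirDeriv_comm (h2 (hD _ (hG p hp)))]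
  simp only [comm]
  rw [← dirDeriv_fun_sum]
  · have hev : (fun q => ∑ i, dirDeriv (0, b i) (dirDeriv (0, b i) G) q) =ᶠ[nhds p]
        fun _ => (0 : ℝ) := by
      filter_upwards [hW.mem_nhds hp] with q hq
      rw [← laplacian_slice b (h2 (hG q hq)), h0 q hq]
    rw [(hev.dirDeriv _).eq_of_nhds]
    simp [dirDeriv]
  · exact fun i _ => (hD _ (hD _ (hG p hp))).differentiableAt (by simp)

end Parameter

/-! ### Derivatives of convolutions -/

section Convolution

variable {V : Type*} [NormedAddCommGroup V] [NormedSpace ℝ V]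

theorem hasCompactSupport_iteratedFDeriv_apply {g : V → ℝ} (hg : HasCompactSupport g) (k : ℕ)
    (m : Fin k → V) : HasCompactSupport fun z => iteratedFDeriv ℝ k g z m :=
  (hg.iteratedFDeriv k).comp_left (g := fun A : ContinuousMultilinearMap ℝ (fun _ : Fin k => V) ℝ =>
    A m) rfl

theorem contDiff_iteratedFDeriv_apply {g : V → ℝ} (hg : ContDiff ℝ ∞ g) (k : ℕ)
    (m : Fin k → V) : ContDiff ℝ ∞ fun z => iteratedFDeriv ℝ k g z m := by
  have : ContDiff ℝ ∞ (iteratedFDeriv ℝ k g) := hg.iteratedFDeriv_right (by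
    exact_mod_cast (le_top : (⊤ : ℕ∞) + k ≤ ⊤))
  exact (ContinuousMultilinearMap.apply ℝ (fun _ : Fin k => V) ℝ m).contDiff.comp this

/-- All derivatives fall on the smooth compactly supported factor, so the other one may be singular,
as `fundSol` is. -/
theorem iteratedFDeriv_convolution_apply [MeasurableSpace V] [BorelSpace V] {μ : Measure V}
    [SFinite μ] [μ.IsAddLeftInvariant] {f g : V → ℝ} (hf : LocallyIntegrable f μ)
    (hg : ContDiff ℝ ∞ g) (hgc : HasCompactSupport g) (k : ℕ) (m : Fin k → V) (x : V) :
    iteratedFDeriv ℝ k (fun y => ∫ t, f t * g (y - t) ∂μ) x m =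
      ∫ t, f t * iteratedFDeriv ℝ k g (x - t) m ∂μ := by
  let L := ContinuousLinearMap.mul ℝ ℝ
  induction k generalizing x with
  | zero => simp
  | succ k ih =>
    have hsm : ContDiff ℝ ∞ fun y => ∫ t, f t * g (y - t) ∂μ :=
      hgc.contDiff_convolution_right L hf hg
    have hap : ∀ {u : V → ℝ} (_ : ContDiff ℝ ∞ u) (y : V),
        iteratedFDeriv ℝ (k + 1) u y m =
          fderiv ℝ (fun z => iteratedFDeriv ℝ k u z (Fin.tail m)) y (m 0) := by
      intro u hu y
      rw [iteratedFDeriv_succ_apply_left]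
      have hd : DifferentiableAt ℝ (iteratedFDeriv ℝ k u) y :=
        (hu.contDiffAt.differentiableAt_iteratedFDeriv (by exact_mod_cast ENat.natCast_lt_top k))
      have := ((ContinuousMultilinearMap.apply ℝ (fun _ : Fin k => V) ℝ
        (Fin.tail m)).hasFDerivAt.comp y hd.hasFDerivAt).fderiv
      erw [this]
      rfl
    rw [hap hsm x]
    simp only [ih (Fin.tail m), hap hg _]
    have hg' := contDiff_iteratedFDeriv_apply hg k (Fin.tail m)
    have hgc' := hasCompactSupport_iteratedFDeriv_apply hgc k (Fin.tail m)
    have := (hgc'.hasFDerivAt_convolution_right L hf (hg'.of_le (by simp)) x).fderiv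
    have h2 := convolution_precompR_apply L hf (hgc'.fderiv ℝ)
      (hg'.continuous_fderiv (by simp)) x (m 0)
    rw [← this] at h2
    exact h2

end Convolution

/-! ### The radial profile of the fundamental solution -/

section Profile

/-- A primitive of `s ↦ s ^ (-ν)` on the positive half line. -/
noncomputable def powPrimitive (ν s : ℝ) : ℝ :=
  if ν = 1 then Real.log s else s ^ (1 - ν) / (1 - ν)

theorem hasDerivAt_powPrimitive (ν : ℝ) {s : ℝ} (hs : 0 < s) :
    HasDerivAt (powPrimitive ν) (s ^ (-ν)) s := by
  unfold powPrimitive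
  split_ifs with h
  · subst h
    rw [Real.rpow_neg_one]
    exact Real.hasDerivAt_log hs.ne'
  · have h' : 1 - ν ≠ 0 := sub_ne_zero.2 (Ne.symm h)
    have := (Real.hasDerivAt_rpow_const (p := 1 - ν) (Or.inl hs.ne')).div_const (1 - ν)
    rwa [mul_div_assoc, mul_comm, div_mul_cancel₀ _ h', show 1 - ν - 1 = -ν by ring] at this

theorem contDiffAt_powPrimitive (ν : ℝ) {s : ℝ} (hs : 0 < s) (n : ℕ∞ω) :
    ContDiffAt ℝ n (powPrimitive ν) s := by
  unfold powPrimitive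
  split_ifs with h
  · exact Real.contDiffAt_log.2 hs.ne'
  · exact (Real.contDiffAt_rpow_const_of_ne hs.ne').div_const _

theorem measurable_powPrimitive (ν : ℝ) : Measurable (powPrimitive ν) := by
  unfold powPrimitive
  split_ifs with h
  · exact Real.measurable_log
  · fun_prop

theorem powPrimitive_mono (ν : ℝ) {s t : ℝ} (hs : 0 < s) (hst : s ≤ t) :
    powPrimitive ν s ≤ powPrimitive ν t := by
  have hm : MonotoneOn (powPrimitive ν) (Set.Ioi 0) := by
    refine monotoneOn_of_deriv_nonneg (convex_Ioi 0)
      (fun x hx => (hasDerivAt_powPrimitive ν hx).continuousAt.continuousWithinAt)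
      (fun x hx => ?_) (fun x hx => ?_)
    · rw [interior_Ioi] at hx
      exact (hasDerivAt_powPrimitive ν hx).differentiableAt.differentiableWithinAt
    · rw [interior_Ioi] at hx
      rw [(hasDerivAt_powPrimitive ν hx).deriv]
      exact Real.rpow_nonneg (le_of_lt hx) _
  exact hm hs (hs.trans_le hst) hst

/-- The true growth is t^(2 - 2ν), or log t when ν = 1; giving up a power of t treats both alike.
For 2ν = n the bound t^(1 - n) is still integrable near the origin of an n-dimensional space. -/
theorem abs_powPrimitive_sq_le {ν : ℝ} (hν : 1 ≤ ν) (r : ℝ) :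
    ∃ C : ℝ, ∀ t : ℝ, 0 < t → t < r → |powPrimitive ν (t ^ 2)| ≤ C * t ^ (-(2 * ν - 1)) := by
  unfold powPrimitive
  split_ifs with h
  · subst h
    refine ⟨2 * (r ^ 2 + 1), fun t ht htr => ?_⟩
    rw [Real.log_pow, show -(2 * (1 : ℝ) - 1) = -1 by ring, Real.rpow_neg_one, abs_mul]
    have h1 : Real.log t ≤ t := (Real.log_le_sub_one_of_pos ht).trans (by linarith)
    have h2 : -Real.log t ≤ t⁻¹ := by
      rw [← Real.log_inv]
      exact (Real.log_le_sub_one_of_pos (inv_pos.2 ht)).trans (by linarith)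
    have h3 : |Real.log t| ≤ t + t⁻¹ := abs_le.2
      ⟨by linarith [inv_pos.2 ht], by linarith [inv_pos.2 ht]⟩
    have h4 : t + t⁻¹ ≤ (r ^ 2 + 1) * t⁻¹ := by
      have : t = t ^ 2 * t⁻¹ := by field_simp
      rw [add_mul, one_mul]
      gcongr
      calc t = t ^ 2 * t⁻¹ := this
        _ ≤ r ^ 2 * t⁻¹ := by gcongr
    norm_num
    nlinarith
  · refine ⟨r / |1 - ν|, fun t ht htr => ?_⟩
    have e : (t ^ 2) ^ (1 - ν) = t * t ^ (-(2 * ν - 1)) := by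
      rw [← Real.rpow_natCast, ← Real.rpow_mul ht.le]
      nth_rewrite 2 [← Real.rpow_one t]
      rw [← Real.rpow_add ht]
      congr 1
      push_cast
      ring
    rw [abs_div, e, abs_of_pos (by positivity), div_mul_eq_mul_div]
    gcongr

end Profile

/-! ### The fundamental solution -/

section FundSol

variable {V : Type*} [NormedAddCommGroup V] [InnerProductSpace ℝ V]

/-- A radial function on `V` which, up to a nonzero factor, is the fundamental solution of the
Laplace equation. -/
noncomputable def fundSol (x : V) : ℝ := powPrimitive (Module.finrank ℝ V / 2) (‖x‖ ^ 2)

theorem contDiffAt_fundSol {x : V} (hx : x ≠ 0) (n : ℕ∞ω) :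
    ContDiffAt ℝ n (fundSol : V → ℝ) x :=
  (contDiffAt_powPrimitive _ (by positivity : 0 < ‖x‖ ^ 2) n).comp x
    (contDiff_norm_sq ℝ).contDiffAt

theorem measurable_fundSol [MeasurableSpace V] [BorelSpace V] : Measurable (fundSol : V → ℝ) :=
  (measurable_powPrimitive _).comp (by fun_prop)

variable [FiniteDimensional ℝ V]

/-- With n = 2ν the two terms of the radial formula cancel up to a multiple of δ. Hence δ = 0 gives
harmonicity off the origin, and δ > 0 an explicit positive bump. -/
theorem laplacian_powPrimitive_add {δ : ℝ} {x : V} (hx : 0 < ‖x‖ ^ 2 + δ) :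
    (Δ fun y : V => powPrimitive (Module.finrank ℝ V / 2) (‖y‖ ^ 2 + δ)) x =
      2 * Module.finrank ℝ V * δ * (‖x‖ ^ 2 + δ) ^ (-(Module.finrank ℝ V / 2 : ℝ) - 1) := by
  set ν : ℝ := Module.finrank ℝ V / 2 with hν
  have hn : (Module.finrank ℝ V : ℝ) = 2 * ν := by rw [hν]; ring
  rw [laplacian_comp_norm_sq (h := fun s => powPrimitive ν (s + δ))
    (h' := fun s => (s + δ) ^ (-ν)) (h'' := -ν * (‖x‖ ^ 2 + δ) ^ (-ν - 1)), hn]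
  · have : (‖x‖ ^ 2 + δ) ^ (-ν) = (‖x‖ ^ 2 + δ) * (‖x‖ ^ 2 + δ) ^ (-ν - 1) := by
      nth_rewrite 2 [← Real.rpow_one (‖x‖ ^ 2 + δ)]
      rw [← Real.rpow_add hx]
      congr 1
      ring
    simp only [this]
    ring
  · exact (contDiffAt_powPrimitive ν hx 2).comp (‖x‖ ^ 2)
      (f := fun s => s + δ) (by fun_prop)
  · have : ∀ᶠ s in nhds (‖x‖ ^ 2), 0 < s + δ :=
      (continuous_add_const δ).continuousAt.eventually (lt_mem_nhds hx)
    filter_upwards [this] with s hs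
    exact (hasDerivAt_powPrimitive ν hs).comp_add_const s δ
  · exact (Real.hasDerivAt_rpow_const (p := -ν) (Or.inl hx.ne')).comp_add_const (‖x‖ ^ 2) δ

theorem laplacian_fundSol {x : V} (hx : x ≠ 0) : (Δ (fundSol : V → ℝ)) x = 0 := by
  have := laplacian_powPrimitive_add (δ := 0) (x := x) (by positivity)
  simp only [add_zero, mul_zero, zero_mul] at this
  exact this

variable [MeasurableSpace V] [BorelSpace V]

theorem locallyIntegrable_fundSol (hV : 2 ≤ Module.finrank ℝ V) :
    LocallyIntegrable (fundSol : V → ℝ) := by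
  have hd : (2 : ℝ) ≤ Module.finrank ℝ V := by exact_mod_cast hV
  have : Nontrivial V := Module.nontrivial_of_finrank_pos (R := ℝ) (by omega)
  rw [locallyIntegrable_iff]
  intro K hK
  obtain ⟨R, hR0, hR⟩ := hK.isBounded.exists_pos_norm_lt
  obtain ⟨C, hC⟩ := abs_powPrimitive_sq_le (ν := Module.finrank ℝ V / 2) (by linarith) R
  refine IntegrableOn.mono_set (t := Metric.ball 0 R) ?_ fun x hx =>
    mem_ball_zero_iff.2 (hR x hx)
  refine integrableOn_ball_of_norm_le_rpow (C := C)
    (α := 2 * (Module.finrank ℝ V / 2 : ℝ) - 1) (by omega) (by linarith) ?_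
    measurable_fundSol.aestronglyMeasurable
  rw [ae_restrict_iff' Metric.isOpen_ball.measurableSet]
  have h0 : ∀ᵐ x : V, x ≠ 0 := by simp [ae_iff]
  filter_upwards [h0] with x hx hxR
  exact hC ‖x‖ (by positivity) (mem_ball_zero_iff.1 hxR)

/-- Regularise E to P(|x|² + a⁻²), with P the profile. Its Laplacian is the rescaled bump aⁿ ψ(ax),
an approximate identity of mass c = ∫ ψ; apply Green's formula and let a → ∞. -/
theorem exists_integral_fundSol_mul_laplacian (hV : 2 ≤ Module.finrank ℝ V) :
    ∃ c : ℝ, 0 < c ∧ ∀ g : V → ℝ, ContDiff ℝ ∞ g → HasCompactSupport g →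
      ∫ x, fundSol x * (Δ g) x = c * g 0 := by
  have hd : (2 : ℝ) ≤ Module.finrank ℝ V := by exact_mod_cast hV
  have : Nontrivial V := Module.nontrivial_of_finrank_pos (R := ℝ) (by omega)
  let n : ℝ := (Module.finrank ℝ V : ℝ)
  have hn : n = (Module.finrank ℝ V : ℝ) := rfl
  let ψ : V → ℝ := fun x => 2 * n * (1 + ‖x‖ ^ 2) ^ (-(n + 2) / 2)
  have hψpos : ∀ x, 0 < ψ x := fun x => by positivity
  have hψint : Integrable ψ :=
    (integrable_rpow_neg_one_add_norm_sq (μ := volume) (E := V) (r := n + 2)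
      (by linarith)).const_mul _
  have hc : 0 < ∫ x, ψ x := by
    rw [integral_pos_iff_support_of_nonneg (fun x => (hψpos x).le) hψint]
    have : Function.support ψ = Set.univ := by
      ext x; simp [(hψpos x).ne']
    rw [this]
    exact Measure.measure_univ_pos.2 (NeZero.ne _)
  refine ⟨∫ x, ψ x, hc, fun g hg hgc => ?_⟩
  have hΔ : ContDiff ℝ ∞ (Δ g) := hg.laplacian
  have hΔc : HasCompactSupport (Δ g) := hgc.laplacian
  let E : ℝ → V → ℝ := fun a x => powPrimitive (n / 2) (‖x‖ ^ 2 + (a ^ 2)⁻¹)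
  have hEsm : ∀ a : ℝ, 0 < a → ContDiff ℝ 2 (E a) := fun a ha =>
    contDiff_iff_contDiffAt.2 fun x =>
      (contDiffAt_powPrimitive _ (by positivity : 0 < ‖x‖ ^ 2 + (a ^ 2)⁻¹) 2).comp x
        (((contDiff_norm_sq ℝ).add contDiff_const).contDiffAt)
  have h2 : (2 : ℕ∞ω) ≤ ∞ := WithTop.coe_le_coe.2 (le_top : (2 : ℕ∞) ≤ ⊤)
  have hΔE : ∀ a : ℝ, 0 < a → ∀ x : V,
      (Δ (E a)) x = a ^ Module.finrank ℝ V * ψ (a • x) := by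
    intro a ha x
    have hpos : 0 < 1 + ‖a • x‖ ^ 2 := by positivity
    rw [laplacian_powPrimitive_add (by positivity)]
    have e : ‖x‖ ^ 2 + (a ^ 2)⁻¹ = (a ^ 2)⁻¹ * (1 + ‖a • x‖ ^ 2) := by
      rw [norm_smul, Real.norm_of_nonneg ha.le]; field_simp; ring
    have e2 : ((a ^ 2)⁻¹ : ℝ) = a ^ (-2 : ℝ) := by
      rw [Real.rpow_neg ha.le]; norm_num
    rw [e, Real.mul_rpow (by positivity) hpos.le, e2, ← Real.rpow_mul ha.le,
      ← Real.rpow_natCast a (Module.finrank ℝ V), ← hn, show -(n / 2) - 1 = -(n + 2) / 2 by ring,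
      show -2 * (-(n + 2) / 2) = n + 2 by ring, Real.rpow_add ha, Real.rpow_neg ha.le]
    simp only [ψ]
    have : a ^ (2 : ℝ) ≠ 0 := by positivity
    field_simp
  have hgreen : ∀ a : ℝ, 0 < a →
      ∫ x, E a x * (Δ g) x = ∫ x, (a ^ Module.finrank ℝ V * ψ (a • x)) * g x := by
    intro a ha
    rw [integral_mul_laplacian (hEsm a ha) (hg.of_le h2) hgc]
    simp only [hΔE a ha]
  have hlim1 : Filter.Tendsto (fun a : ℝ => ∫ x, E a x * (Δ g) x) Filter.atTop
      (nhds (∫ x, fundSol x * (Δ g) x)) := by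
    -- The profile is increasing, so for a ≥ 1 the regularised kernel lies between `fundSol` and `E
    -- 1`, and is dominated by the sum of their absolute values.
    refine tendsto_integral_filter_of_dominated_convergence
      (fun x => |fundSol x| * |(Δ g) x| + |E 1 x| * |(Δ g) x|) ?_ ?_ ?_ ?_
    · filter_upwards [Filter.eventually_gt_atTop 0] with a ha
      exact ((hEsm a ha).continuous.mul hΔ.continuous).aestronglyMeasurable
    · filter_upwards [Filter.eventually_ge_atTop 1] with a ha
      have h0 : ∀ᵐ x : V, x ≠ 0 := by simp [ae_iff]
      filter_upwards [h0] with x hx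
      have hxp : 0 < ‖x‖ ^ 2 := by positivity
      have hap : 0 < (a ^ 2)⁻¹ := by positivity
      have l1 : fundSol x ≤ E a x := powPrimitive_mono _ hxp (by linarith)
      have l2 : E a x ≤ E 1 x := powPrimitive_mono _ (by positivity) (by
        have : (a ^ 2)⁻¹ ≤ (1 ^ 2)⁻¹ := by gcongr
        linarith)
      rw [← add_mul, norm_mul, Real.norm_eq_abs, Real.norm_eq_abs]
      refine mul_le_mul_of_nonneg_right (abs_le.2 ⟨?_, ?_⟩) (abs_nonneg _)
      · linarith [neg_abs_le (fundSol x), abs_nonneg (E 1 x)]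
      · linarith [le_abs_self (E 1 x), abs_nonneg (fundSol x)]
    · have i1 : Integrable fun x => (Δ g) x • fundSol x :=
        (locallyIntegrable_fundSol hV).integrable_smul_left_of_hasCompactSupport
          hΔ.continuous hΔc
      have i2 : Integrable fun x => E 1 x * (Δ g) x :=
        ((hEsm 1 one_pos).continuous.mul hΔ.continuous).integrable_of_hasCompactSupport
          hΔc.mul_left
      refine Integrable.add ?_ ?_
      · simpa [mul_comm] using i1.norm
      · simpa using i2.norm
    · have h0 : ∀ᵐ x : V, x ≠ 0 := by simp [ae_iff]
      filter_upwards [h0] with x hx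
      have hxp : 0 < ‖x‖ ^ 2 := by positivity
      refine Filter.Tendsto.mul_const _ ?_
      have hs : Filter.Tendsto (fun a : ℝ => ‖x‖ ^ 2 + (a ^ 2)⁻¹) Filter.atTop
          (nhds (‖x‖ ^ 2)) := by
        have := (tendsto_inv_atTop_zero.comp
          (Filter.tendsto_pow_atTop (α := ℝ) two_ne_zero)).const_add (‖x‖ ^ 2)
        simpa using this
      exact (hasDerivAt_powPrimitive _ hxp).continuousAt.tendsto.comp hs
  have hlim2 : Filter.Tendsto (fun a : ℝ => ∫ x, (a ^ Module.finrank ℝ V * ψ (a • x)) * g x)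
      Filter.atTop (nhds ((∫ x, ψ x) * g 0)) := by
    set c := ∫ x, ψ x with hcdef
    -- The approximate identity theorem wants a kernel of mass one that is o(|x|⁻ⁿ) at infinity;
    -- here c⁻¹ ψ is O(|x|⁻ⁿ⁻²).
    have hdecay : Filter.Tendsto (fun x : V => ‖x‖ ^ Module.finrank ℝ V * (c⁻¹ * ψ x))
        (Bornology.cobounded V) (nhds 0) := by
      have hb : Filter.Tendsto (fun x : V => c⁻¹ * (2 * n) * (‖x‖ ^ 2)⁻¹)
          (Bornology.cobounded V) (nhds 0) := by
        have := ((tendsto_inv_atTop_zero.comp (Filter.tendsto_pow_atTop (α := ℝ) two_ne_zero)).comp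
          (tendsto_norm_cobounded_atTop (E := V))).const_mul (c⁻¹ * (2 * n))
        simpa using this
      refine tendsto_of_tendsto_of_tendsto_of_le_of_le' tendsto_const_nhds hb ?_ ?_
      · exact Filter.Eventually.of_forall fun x =>
          mul_nonneg (by positivity) (mul_nonneg (inv_nonneg.2 hc.le) (hψpos x).le)
      · filter_upwards [Bornology.eventually_ne_cobounded (0 : V)] with x hx
        have hxp : 0 < ‖x‖ := by positivity
        have key : (1 + ‖x‖ ^ 2) ^ (-(n + 2) / 2) ≤ (‖x‖ ^ Module.finrank ℝ V)⁻¹ * (‖x‖ ^ 2)⁻¹ := by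
          calc (1 + ‖x‖ ^ 2) ^ (-(n + 2) / 2) ≤ (‖x‖ ^ 2) ^ (-(n + 2) / 2) :=
                Real.rpow_le_rpow_of_nonpos (by positivity) (by linarith) (by linarith)
            _ = (‖x‖ ^ Module.finrank ℝ V)⁻¹ * (‖x‖ ^ 2)⁻¹ := by
                rw [← Real.rpow_natCast ‖x‖ 2, ← Real.rpow_mul hxp.le, ← Real.rpow_natCast,
                  ← Real.rpow_neg hxp.le, ← Real.rpow_neg hxp.le, ← Real.rpow_add hxp]
                congr 1
                push_cast
                ring
        calc ‖x‖ ^ Module.finrank ℝ V * (c⁻¹ * ψ x)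
            = c⁻¹ * (2 * n) * (‖x‖ ^ Module.finrank ℝ V * (1 + ‖x‖ ^ 2) ^ (-(n + 2) / 2)) := by
              simp only [ψ]; ring
          _ ≤ c⁻¹ * (2 * n) * (‖x‖ ^ Module.finrank ℝ V *
                ((‖x‖ ^ Module.finrank ℝ V)⁻¹ * (‖x‖ ^ 2)⁻¹)) := by gcongr
          _ = c⁻¹ * (2 * n) * (‖x‖ ^ 2)⁻¹ := by field_simp
    have := (tendsto_integral_comp_smul_smul_of_integrable (μ := (volume : Measure V))
      (φ := fun x => c⁻¹ * ψ x) (fun x => mul_nonneg (inv_nonneg.2 hc.le) (hψpos x).le)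
      (by rw [integral_const_mul]; exact inv_mul_cancel₀ hc.ne') hdecay
      (hg.continuous.integrable_of_hasCompactSupport hgc) hg.continuous.continuousAt).const_mul c
    refine this.congr fun a => ?_
    rw [← integral_const_mul]
    congr 1 with x
    rw [smul_eq_mul]
    field_simp
  refine tendsto_nhds_unique (hlim1.congr' ?_) hlim2
  filter_upwards [Filter.eventually_gt_atTop 0] with a ha
  exact hgreen a ha

end FundSol

/-! ### Newton potentials and the reproducing kernel -/

section Potential

variable {V : Type*} [NormedAddCommGroup V] [InnerProductSpace ℝ V] [FiniteDimensional ℝ V]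
  [MeasurableSpace V] [BorelSpace V]

/-- The convolution of `fundSol` with `f`. -/
noncomputable def newtonPotential (f : V → ℝ) (x : V) : ℝ := ∫ t, fundSol t * f (x - t)

theorem newtonPotential_eq (f : V → ℝ) (x : V) :
    newtonPotential f x = ∫ y, f y * fundSol (x - y) := by
  have := integral_sub_left_eq_self (fun t => fundSol t * f (x - t)) volume x
  simp only [sub_sub_cancel] at this
  rw [newtonPotential, ← this]
  simp only [mul_comm]

theorem contDiff_newtonPotential (hV : 2 ≤ Module.finrank ℝ V) {f : V → ℝ} (hf : ContDiff ℝ ∞ f)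
    (hfc : HasCompactSupport f) : ContDiff ℝ ∞ (newtonPotential f) :=
  hfc.contDiff_convolution_right (ContinuousLinearMap.mul ℝ ℝ) (locallyIntegrable_fundSol hV) hf

/-- Differentiating on the side of f leaves E paired with the Laplacian of y ↦ f (x - y), the shape
to which the fundamental solution identity applies. -/
theorem laplacian_newtonPotential (hV : 2 ≤ Module.finrank ℝ V) {f : V → ℝ}
    (hf : ContDiff ℝ ∞ f) (hfc : HasCompactSupport f) (x : V) :
    (Δ (newtonPotential f)) x = ∫ t, fundSol t * (Δ fun y => f (x - y)) t := by
  have h2 : (2 : ℕ∞ω) ≤ ∞ := WithTop.coe_le_coe.2 (le_top : (2 : ℕ∞) ≤ ⊤)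
  have hE := locallyIntegrable_fundSol hV
  rw [InnerProductSpace.laplacian_eq_iteratedFDeriv_stdOrthonormalBasis]
  unfold newtonPotential
  simp only [iteratedFDeriv_convolution_apply hE hf hfc]
  rw [← integral_finsetSum]
  · congr 1 with t
    rw [laplacian_comp_sub_left f x (hf.of_le h2).contDiffAt, ← Finset.mul_sum,
      InnerProductSpace.laplacian_eq_iteratedFDeriv_stdOrthonormalBasis]
  · intro i _
    exact (hasCompactSupport_iteratedFDeriv_apply hfc 2 _).convolutionExists_right
      (ContinuousLinearMap.mul ℝ ℝ) hE (contDiff_iteratedFDeriv_apply hf 2 _).continuous x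

/-- Every test function which is harmonic near a point is reproduced there by convolution with
a suitable test function supported near the origin. -/
theorem exists_reproducing_kernel (hV : 2 ≤ Module.finrank ℝ V) {ε : ℝ} (hε : 0 < ε) :
    ∃ ρ : V → ℝ, ContDiff ℝ ∞ ρ ∧ tsupport ρ ⊆ Metric.closedBall 0 ε ∧
      ∀ w : V → ℝ, ContDiff ℝ ∞ w → HasCompactSupport w → ∀ x : V,
        (∀ y ∈ Metric.closedBall x ε, (Δ w) y = 0) → ∫ t, w t * ρ (x - t) = w x := by
  obtain ⟨c, hc, hfund⟩ := exists_integral_fundSol_mul_laplacian hV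
  have h2 : (2 : ℕ∞ω) ≤ ∞ := WithTop.coe_le_coe.2 (le_top : (2 : ℕ∞) ≤ ⊤)
  let θ : ContDiffBump (0 : V) := ⟨ε / 2, ε, by positivity, by linarith⟩
  -- F is E with its singularity cut out: smooth everywhere and equal to E off the ε-ball. So ΔF
  -- lives in that ball, and c⁻¹ ΔF is the kernel.
  let F : V → ℝ := fun x => (1 - θ x) * fundSol x
  have hF : ContDiff ℝ ∞ F := contDiff_iff_contDiffAt.2 fun x => by
    rcases eq_or_ne x 0 with rfl | hx
    · have : F =ᶠ[nhds 0] fun _ => (0 : ℝ) := by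
        filter_upwards [Metric.closedBall_mem_nhds (0 : V) (by positivity : 0 < ε / 2)] with y hy
        simp only [F, θ.one_of_mem_closedBall hy, sub_self, zero_mul]
      exact contDiffAt_const.congr_of_eventuallyEq this
    · exact (contDiffAt_const.sub θ.contDiffAt).mul (contDiffAt_fundSol hx _)
  have hout : ∀ x ∉ Metric.closedBall (0 : V) ε, F =ᶠ[nhds x] fundSol := by
    intro x hx
    filter_upwards [Metric.isClosed_closedBall.isOpen_compl.mem_nhds hx] with y hy
    have : θ y = 0 := θ.zero_of_le_dist (by
      have : ¬ dist y 0 ≤ ε := hy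
      exact (not_le.1 this).le)
    simp only [F, this, sub_zero, one_mul]
  have hΔF : ContDiff ℝ ∞ (Δ F) := hF.laplacian
  refine ⟨fun x => c⁻¹ * (Δ F) x, hΔF.const_smul c⁻¹, ?_, fun w hw hwc x hx => ?_⟩
  · refine closure_minimal (fun x hx => ?_) Metric.isClosed_closedBall
    by_contra h
    have hx0 : x ≠ 0 := by rintro rfl; exact h (Metric.mem_closedBall_self hε.le)
    refine hx ?_
    simp only
    rw [(InnerProductSpace.laplacian_congr_nhds (hout x h)).eq_of_nhds, laplacian_fundSol hx0,
      mul_zero]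
  · let g : V → ℝ := fun y => w (x - y)
    have hg : ContDiff ℝ ∞ g := hw.comp (contDiff_const.sub contDiff_id)
    have hgc : HasCompactSupport g :=
      hwc.comp_homeomorph (Homeomorph.subLeft x)
    have hgΔ : ∀ y ∈ Metric.closedBall (0 : V) ε, (Δ g) y = 0 := by
      intro y hy
      rw [laplacian_comp_sub_left w x (hw.of_le h2).contDiffAt]
      refine hx _ ?_
      simpa [dist_eq_norm] using hy
    -- F and E differ only where Δg = 0, so F may replace E in the fundamental solution identity;
    -- Green's formula then moves Δ onto F.
    have e1 : ∀ y, F y * (Δ g) y = fundSol y * (Δ g) y := by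
      intro y
      by_cases hy : y ∈ Metric.closedBall (0 : V) ε
      · rw [hgΔ y hy, mul_zero, mul_zero]
      · rw [(hout y hy).eq_of_nhds]
    have e2 := integral_mul_laplacian (hF.of_le h2) (hg.of_le h2) hgc
    simp only [e1] at e2
    rw [hfund g hg hgc] at e2
    have e3 := integral_sub_left_eq_self (fun t => w t * (c⁻¹ * (Δ F) (x - t))) volume x
    simp only [sub_sub_cancel] at e3
    rw [← e3]
    calc ∫ y, w (x - y) * (c⁻¹ * (Δ F) y) = ∫ y, c⁻¹ * ((Δ F) y * g y) := by
          congr 1 with y; simp only [g]; ring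
      _ = w x := by
          rw [integral_const_mul, ← e2, inv_mul_cancel_left₀ hc.ne']
          simp [g]

end Potential

/-! ### Holomorphic extension of the profile -/

section ComplexPrimitive

/-- The holomorphic extension of `powPrimitive ν` to the slit plane. -/
noncomputable def complexPowPrimitive (ν : ℝ) (z : ℂ) : ℂ :=
  if ν = 1 then Complex.log z else z ^ ((1 - ν : ℝ) : ℂ) / ((1 - ν : ℝ) : ℂ)

theorem complexPowPrimitive_ofReal (ν : ℝ) {s : ℝ} (hs : 0 ≤ s) :
    complexPowPrimitive ν s = powPrimitive ν s := by
  unfold complexPowPrimitive powPrimitive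
  split_ifs
  · exact (Complex.ofReal_log hs).symm
  · rw [← Complex.ofReal_cpow hs, ← Complex.ofReal_div]

theorem differentiableAt_complexPowPrimitive (ν : ℝ) {z : ℂ} (hz : z ∈ Complex.slitPlane) :
    DifferentiableAt ℂ (complexPowPrimitive ν) z := by
  unfold complexPowPrimitive
  split_ifs
  · exact Complex.differentiableAt_log hz
  · exact ((differentiableAt_id.cpow_const hz)).div_const _

/-- The real part is at least |p|² (1 - 5/8 - 25/256). So |p + zq|², extended as a polynomial in z,
stays in the slit plane on a disc of radius larger than 1. -/
theorem re_quadratic_pos {V : Type*} [NormedAddCommGroup V] [InnerProductSpace ℝ V] {p q : V}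
    (hp : p ≠ 0) (hpq : 4 * ‖q‖ ≤ ‖p‖) {z : ℂ} (hz : ‖z‖ ≤ 5 / 4) :
    0 < (((‖p‖ ^ 2 : ℝ) : ℂ) + ((2 * inner ℝ p q : ℝ) : ℂ) * z +
      ((‖q‖ ^ 2 : ℝ) : ℂ) * z ^ 2).re := by
  have hp0 : 0 < ‖p‖ := norm_pos_iff.2 hp
  have h1 : ‖((2 * inner ℝ p q : ℝ) : ℂ) * z‖ ≤ 2 * (‖p‖ * ‖q‖) * (5 / 4) := by
    rw [norm_mul, Complex.norm_real, Real.norm_eq_abs, abs_mul, abs_two]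
    gcongr
    exact abs_real_inner_le_norm p q
  have h2 : ‖((‖q‖ ^ 2 : ℝ) : ℂ) * z ^ 2‖ ≤ ‖q‖ ^ 2 * (5 / 4) ^ 2 := by
    rw [norm_mul, Complex.norm_real, norm_pow z, Real.norm_of_nonneg (by positivity)]
    gcongr
  have h3 := (abs_le.1 (Complex.abs_re_le_norm (((2 * inner ℝ p q : ℝ) : ℂ) * z))).1
  have h4 := (abs_le.1 (Complex.abs_re_le_norm (((‖q‖ ^ 2 : ℝ) : ℂ) * z ^ 2))).1
  have h5 : ‖p‖ * ‖q‖ ≤ ‖p‖ ^ 2 / 4 := by nlinarith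
  have h6 : ‖q‖ ^ 2 ≤ ‖p‖ ^ 2 / 16 := by nlinarith [norm_nonneg q]
  rw [Complex.add_re, Complex.add_re, Complex.ofReal_re]
  have h7 : 0 < ‖p‖ ^ 2 := by positivity
  linarith

end ComplexPrimitive

/-! ### Taylor expansion of the kernel along an affine pencil -/

section Pencil

theorem contDiffAt_iterate_dirDeriv {X : Type*} [NormedAddCommGroup X] [NormedSpace ℝ X]
    {G : X → ℝ} {p : X} (hG : ContDiffAt ℝ ∞ G p) (v : X) (k : ℕ) :
    ContDiffAt ℝ ∞ ((dirDeriv v)^[k] G) p := by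
  induction k with
  | zero => exact hG
  | succ k ih =>
    rw [Function.iterate_succ_apply']
    exact ih.dirDeriv (by simp) v

/-- On the real axis complex derivatives of a holomorphic function are the real ones. Thus Cauchy's
estimates for F bound the parameter derivatives of G, taken in the direction (1, 0). -/
theorem iteratedDeriv_eq_iterate_dirDeriv {V : Type*} [NormedAddCommGroup V]
    [NormedSpace ℝ V] {F : ℂ → ℂ} {r : ℝ}
    (hF : DifferentiableOn ℂ F (Metric.ball 0 r)) {G : ℝ × V → ℝ} {y : V}
    (hG : ∀ t : ℝ, |t| < r → ContDiffAt ℝ ∞ G (t, y)) (h : ∀ t : ℝ, |t| < r → F t = G (t, y))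
    (k : ℕ) : ∀ t : ℝ, |t| < r → iteratedDeriv k F t = ((dirDeriv (1, 0))^[k] G (t, y) : ℝ) := by
  induction k with
  | zero => simpa using h
  | succ k ih =>
    intro t ht
    rw [iteratedDeriv_succ, Function.iterate_succ_apply']
    have hmem : (t : ℂ) ∈ Metric.ball (0 : ℂ) r := by simpa using ht
    have hd : DifferentiableAt ℂ (iteratedDeriv k F) t := by
      have han : AnalyticAt ℂ F t :=
        (hF.analyticOnNhd Metric.isOpen_ball) _ hmem
      exact (han.iterated_deriv k |>.differentiableAt).congr_of_eventuallyEq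
        (by rw [iteratedDeriv_eq_iterate])
    have h1 := hd.hasDerivAt.comp_ofReal
    have hGd := (contDiffAt_iterate_dirDeriv (hG t ht) (1, 0) k).differentiableAt (by simp)
    have h2 : HasDerivAt (fun s : ℝ => (dirDeriv (1, 0))^[k] G (s, y))
        (dirDeriv (1, 0) ((dirDeriv (1, 0))^[k] G) (t, y)) t := by
      have := hGd.hasFDerivAt.comp_hasDerivAt t
        ((hasDerivAt_id t).prodMk (hasDerivAt_const t y))
      exact this
    have hev : (fun s : ℝ => iteratedDeriv k F s) =ᶠ[nhds t]
        fun s => (((dirDeriv (1, 0))^[k] G (s, y) : ℝ) : ℂ) := by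
      filter_upwards [continuous_abs.continuousAt.eventually (gt_mem_nhds ht)] with s hs
      exact ih s hs
    exact h1.unique (h2.ofReal_comp.congr_of_eventuallyEq hev)

variable {V : Type*} [NormedAddCommGroup V] [InnerProductSpace ℝ V] [FiniteDimensional ℝ V]

theorem laplacian_slice_iterate_dirDeriv_eq_zero {G : ℝ × V → ℝ} {W : Set (ℝ × V)}
    (hW : IsOpen W) (hG : ∀ p ∈ W, ContDiffAt ℝ ∞ G p)
    (h0 : ∀ p ∈ W, (Δ fun y => G (p.1, y)) p.2 = 0) (v : ℝ × V) (k : ℕ) :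
    ∀ p ∈ W, (Δ fun y => (dirDeriv v)^[k] G (p.1, y)) p.2 = 0 := by
  induction k with
  | zero => exact h0
  | succ k ih =>
    intro p hp
    rw [Function.iterate_succ_apply']
    exact laplacian_slice_dirDeriv_eq_zero hW
      (fun q hq => contDiffAt_iterate_dirDeriv (hG q hq) v k) ih v hp

variable [MeasurableSpace V] [BorelSpace V]

/-- If a test function is orthogonal to all harmonic functions on `U`, then it is orthogonal to
`fundSol` composed with an affine map which is a small perturbation of one that does not vanish
on `U`. -/
theorem integral_mul_fundSol_eq_zero {f : V → ℝ} {U : Set V} (hU : IsOpen U) (hf : Continuous f)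
    (hfc : HasCompactSupport f) (hfU : tsupport f ⊆ U)
    (horth : ∀ u : V → ℝ, (∀ x ∈ U, ContDiffAt ℝ ∞ u x) → (∀ x ∈ U, (Δ u) x = 0) →
      ∫ x, f x * u x = 0)
    (a₀ a₁ : V) (b₀ b₁ : ℝ) (hne : ∀ y ∈ U, a₀ - b₀ • y ≠ 0)
    (hsmall : ∀ y ∈ tsupport f, 4 * ‖a₁ - b₁ • y‖ ≤ ‖a₀ - b₀ • y‖) :
    ∫ y, f y * fundSol (a₀ - b₀ • y + (a₁ - b₁ • y)) = 0 := by
  have h2 : (2 : ℕ∞ω) ≤ ∞ := WithTop.coe_le_coe.2 (le_top : (2 : ℕ∞) ≤ ⊤)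
  let ν : ℝ := (Module.finrank ℝ V : ℝ) / 2
  let p : V → V := fun y => a₀ - b₀ • y
  let q : V → V := fun y => a₁ - b₁ • y
  have hpc : Continuous p := by fun_prop
  have hqc : Continuous q := by fun_prop
  let G : ℝ × V → ℝ := fun z => fundSol (p z.2 + z.1 • q z.2)
  let W : Set (ℝ × V) := {z | p z.2 + z.1 • q z.2 ≠ 0}
  have hW : IsOpen W := isOpen_ne_fun (by fun_prop) continuous_const
  have hG : ∀ z ∈ W, ContDiffAt ℝ ∞ G z := by
    intro z hz
    have hA : ContDiff ℝ ∞ fun z : ℝ × V => p z.2 + z.1 • q z.2 := by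
      simp only [p, q]; fun_prop
    exact ContDiffAt.comp (g := fundSol) z (contDiffAt_fundSol hz _) hA.contDiffAt
  have hG0 : ∀ z ∈ W, (Δ fun y => G (z.1, y)) z.2 = 0 := by
    intro z hz
    have e : ∀ y, p y + z.1 • q y = (a₀ + z.1 • a₁) + (-(b₀ + z.1 * b₁)) • y := by
      intro y; simp only [p, q]; module
    have hz' : (a₀ + z.1 • a₁) + (-(b₀ + z.1 * b₁)) • z.2 ≠ 0 := by rw [← e]; exact hz
    simp only [G, e]
    rw [laplacian_comp_add_smul fundSol _ _ (contDiffAt_fundSol hz' _), laplacian_fundSol hz',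
      mul_zero]
  -- Up to the factor 1/k!, these are the Taylor coefficients at t = 0 of t ↦ E(p + tq).
  let u : ℕ → V → ℝ := fun k y => (dirDeriv (1, 0))^[k] G (0, y)
  have hmem : ∀ y ∈ U, ((0 : ℝ), y) ∈ W := fun y hy => by simpa [W] using hne y hy
  have husm : ∀ k, ∀ y ∈ U, ContDiffAt ℝ ∞ (u k) y := fun k y hy =>
    ContDiffAt.comp (g := (dirDeriv (1, 0))^[k] G) y
      (contDiffAt_iterate_dirDeriv (hG _ (hmem y hy)) _ k)
      (contDiffAt_const.prodMk contDiffAt_id)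
  have hu0 : ∀ k, ∫ y, f y * u k y = 0 := fun k => horth _ (husm k) fun y hy =>
    laplacian_slice_iterate_dirDeriv_eq_zero hW hG hG0 (1, 0) k (0, y) (hmem y hy)
  -- Q extends |p + tq|² to complex t, so F extends t ↦ G (t, y) holomorphically.
  let Q : V → ℂ → ℂ := fun y z => ((‖p y‖ ^ 2 : ℝ) : ℂ) + ((2 * inner ℝ (p y) (q y) : ℝ) : ℂ) * z +
    ((‖q y‖ ^ 2 : ℝ) : ℂ) * z ^ 2
  let F : V → ℂ → ℂ := fun y z => complexPowPrimitive ν (Q y z)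
  have hQslit : ∀ y ∈ tsupport f, ∀ z : ℂ, ‖z‖ ≤ 5 / 4 → Q y z ∈ Complex.slitPlane :=
    fun y hy z hz => Or.inl (re_quadratic_pos (hne y (hfU hy)) (hsmall y hy) hz)
  have hFdiff : ∀ y ∈ tsupport f, DifferentiableOn ℂ (F y) (Metric.ball 0 (5 / 4)) := by
    intro y hy z hz
    have hz' : ‖z‖ ≤ 5 / 4 := (mem_ball_zero_iff.1 hz).le
    refine DifferentiableAt.differentiableWithinAt ?_
    refine DifferentiableAt.comp z (f := Q y)
      (differentiableAt_complexPowPrimitive ν (hQslit y hy z hz')) ?_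
    simp only [Q]; fun_prop
  obtain ⟨M, hM⟩ : ∃ M : ℝ, ∀ y ∈ tsupport f, ∀ z : ℂ, ‖z‖ ≤ 5 / 4 → ‖F y z‖ ≤ M := by
    have hK : IsCompact ((tsupport f) ×ˢ Metric.closedBall (0 : ℂ) (5 / 4)) :=
      IsCompact.prod hfc (isCompact_closedBall _ _)
    have hc : ContinuousOn (fun a : V × ℂ => F a.1 a.2)
        ((tsupport f) ×ˢ Metric.closedBall (0 : ℂ) (5 / 4)) := by
      intro a ha
      have hQc : Continuous fun a : V × ℂ => Q a.1 a.2 := by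
        simp only [Q]; fun_prop
      exact (ContinuousAt.comp (f := fun a : V × ℂ => Q a.1 a.2)
        (differentiableAt_complexPowPrimitive ν (hQslit a.1 ha.1 a.2
          (mem_closedBall_zero_iff.1 ha.2))).continuousAt hQc.continuousAt).continuousWithinAt
    obtain ⟨M, hM⟩ := hK.exists_bound_of_continuousOn hc
    exact ⟨M, fun y hy z hz => hM (y, z) ⟨hy, mem_closedBall_zero_iff.2 hz⟩⟩
  have hQreal : ∀ y (t : ℝ), Q y t = ((‖p y + t • q y‖ ^ 2 : ℝ) : ℂ) := by
    intro y t
    rw [norm_add_sq_real, norm_smul, inner_smul_right, mul_pow, Real.norm_eq_abs, sq_abs]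
    simp only [Q]
    push_cast
    ring
  have hFreal : ∀ y (t : ℝ), F y t = (G (t, y) : ℝ) := by
    intro y t
    simp only [F, hQreal, G, fundSol]
    exact complexPowPrimitive_ofReal ν (by positivity)
  have hderiv : ∀ k, ∀ y ∈ tsupport f, iteratedDeriv k (F y) 0 = (u k y : ℝ) := by
    intro k y hy
    have := iteratedDeriv_eq_iterate_dirDeriv (hFdiff y hy) (G := G) (y := y) (fun t ht => ?_)
      (fun t _ => hFreal y t) k 0 (by norm_num)
    · simpa using this
    · refine hG _ fun h0 => ?_
      have hpos := re_quadratic_pos (hne y (hfU hy)) (hsmall y hy) (z := t) (by simpa using ht.le)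
      have e : (Q y t).re = 0 := by
        rw [hQreal, Complex.ofReal_re]
        have : p y + t • q y = 0 := h0
        rw [this]; simp
      exact hpos.ne' e
  -- Cauchy's estimate on the circle of radius 9/8, between the evaluation point 1 and the radius
  -- 5/4 of holomorphy, gives a geometric bound uniform in y, so the series can be integrated term
  -- by term.
  have hbound : ∀ k, ∀ y ∈ tsupport f, |((k.factorial : ℝ)⁻¹ * u k y)| ≤ M * (8 / 9) ^ k := by
    intro k y hy
    have := Complex.norm_iteratedDeriv_le_of_forall_mem_sphere_norm_le (c := 0) (R := 9 / 8)
      (C := M) (f := F y) k (by norm_num)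
      ((hFdiff y hy).diffContOnCl_ball (Metric.closedBall_subset_ball (by norm_num)))
      (fun z hz => hM y hy z (by rw [mem_sphere_zero_iff_norm.1 hz]; norm_num))
    rw [hderiv k y hy, Complex.norm_real, Real.norm_eq_abs] at this
    have hk : (0 : ℝ) < k.factorial := by positivity
    rw [abs_mul, abs_of_pos (inv_pos.2 hk)]
    calc (k.factorial : ℝ)⁻¹ * |u k y| ≤ (k.factorial : ℝ)⁻¹ * (k.factorial * M / (9 / 8) ^ k) := by
          gcongr
      _ = M * (8 / 9) ^ k := by
          rw [show (8 / 9 : ℝ) = (9 / 8)⁻¹ by norm_num, inv_pow]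
          field_simp
  have hsum : ∀ y ∈ tsupport f, HasSum (fun k : ℕ => (k.factorial : ℝ)⁻¹ * u k y)
      (fundSol (p y + q y)) := by
    intro y hy
    have := Complex.hasSum_taylorSeries_on_ball (hFdiff y hy) (z := 1) (by simp; norm_num)
    have e1 : F y 1 = ((fundSol (p y + q y) : ℝ) : ℂ) := by
      have := hFreal y 1
      simpa [G] using this
    rw [e1] at this
    rw [← Complex.hasSum_ofReal]
    simpa [hderiv _ y hy] using this
  have hcont : ∀ k, Continuous fun y => f y * ((k.factorial : ℝ)⁻¹ * u k y) := by
    intro k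
    refine ContinuousOn.continuous_of_tsupport_subset (s := U) ?_ hU ?_
    · exact hf.continuousOn.mul (continuousOn_const.mul fun y hy =>
        (husm k y hy).continuousAt.continuousWithinAt)
    · exact (tsupport_mul_subset_left).trans hfU
  have hint : ∀ k, Integrable fun y => f y * ((k.factorial : ℝ)⁻¹ * u k y) := fun k =>
    (hcont k).integrable_of_hasCompactSupport hfc.mul_right
  have hfi : Integrable fun y => |f y| := (hf.integrable_of_hasCompactSupport hfc).abs
  have hS := hasSum_integral_of_summable_integral_norm hint ?_
  · have hz : ∀ k : ℕ, ∫ y, f y * ((k.factorial : ℝ)⁻¹ * u k y) = 0 := by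
      intro k
      have : ∀ y, f y * ((k.factorial : ℝ)⁻¹ * u k y) = (k.factorial : ℝ)⁻¹ * (f y * u k y) :=
        fun y => by ring
      simp only [this]
      rw [integral_const_mul, hu0, mul_zero]
    simp only [hz] at hS
    have := hS.unique hasSum_zero
    rw [← this]
    congr 1 with y
    by_cases hy : y ∈ tsupport f
    · exact ((hsum y hy).mul_left (f y)).tsum_eq.symm
    · simp [image_eq_zero_of_notMem_tsupport hy]
  · refine Summable.of_nonneg_of_le (fun k => integral_nonneg fun y => norm_nonneg _)
      (fun k => ?_) ((summable_geometric_of_lt_one (by norm_num : (0 : ℝ) ≤ 8 / 9)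
        (by norm_num)).mul_left ((∫ y, |f y|) * M))
    calc ∫ y, ‖f y * ((k.factorial : ℝ)⁻¹ * u k y)‖ ≤ ∫ y, |f y| * (M * (8 / 9) ^ k) := by
          refine integral_mono (hint k).norm (hfi.mul_const _) fun y => ?_
          simp only [norm_mul (f y), Real.norm_eq_abs]
          by_cases hy : y ∈ tsupport f
          · exact mul_le_mul_of_nonneg_left (hbound k y hy) (abs_nonneg _)
          · simp [image_eq_zero_of_notMem_tsupport hy]
      _ = (∫ y, |f y|) * M * (8 / 9) ^ k := by rw [integral_mul_const]; ring

end Pencil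

/-! ### Test functions orthogonal to all harmonic functions -/

section Orthogonal

variable {V : Type*} [NormedAddCommGroup V] [InnerProductSpace ℝ V] [FiniteDimensional ℝ V]
  [MeasurableSpace V] [BorelSpace V]

/-- A test function on `U` which is orthogonal to all harmonic functions on `U` has a Newton
potential with compact support in `U`. -/
theorem newtonPotential_compactSupport {f : V → ℝ} {U : Set V} (hU : IsOpen U) (hf : Continuous f)
    (hfc : HasCompactSupport f) (hfU : tsupport f ⊆ U)
    (horth : ∀ u : V → ℝ, (∀ x ∈ U, ContDiffAt ℝ ∞ u x) → (∀ x ∈ U, (Δ u) x = 0) →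
      ∫ x, f x * u x = 0) :
    HasCompactSupport (newtonPotential f) ∧ tsupport (newtonPotential f) ⊆ U := by
  have hloc : ∀ x₀ ∉ U, newtonPotential f =ᶠ[nhds x₀] fun _ => (0 : ℝ) := by
    intro x₀ hx₀
    obtain ⟨δ, hδ, hball⟩ := Metric.isOpen_iff.1 (isClosed_tsupport f).isOpen_compl x₀
      fun h => hx₀ (hfU h)
    filter_upwards [Metric.ball_mem_nhds x₀ (by positivity : 0 < δ / 4)] with x hx
    -- The pencil is x₀ - y + t(x - x₀). Its base point is nonzero for y in U since x₀ ∉ U, and the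
    -- radius δ/4 supplies the factor 4 in the smallness condition.
    have key := integral_mul_fundSol_eq_zero hU hf hfc hfU horth x₀ (x - x₀) 1 0
      (fun y hy h => hx₀ (by
        rw [one_smul, sub_eq_zero] at h
        rwa [h])) (fun y hy => ?_)
    · rw [newtonPotential_eq, ← key]
      congr 1 with y
      congr 2
      module
    · rw [mem_ball_iff_norm] at hx
      have : δ ≤ ‖x₀ - y‖ := by
        by_contra h
        exact hball (by rw [mem_ball_iff_norm, norm_sub_rev]; exact not_le.1 h) hy
      simp only [zero_smul, sub_zero, one_smul]
      linarith
  have hinf : ∃ R : ℝ, ∀ x, R < ‖x‖ → newtonPotential f x = 0 := by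
    obtain ⟨R, hR0, hR⟩ := (IsCompact.isBounded hfc).exists_pos_norm_le
    refine ⟨4 * R, fun x hx => ?_⟩
    -- The pencil is now x - ty, whose base point x does not depend on y; its smallness condition is
    -- 4|y| ≤ |x|.
    have key := integral_mul_fundSol_eq_zero hU hf hfc hfU horth x 0 0 1
      (fun y _ h => by
        rw [zero_smul, sub_zero] at h
        rw [h, norm_zero] at hx
        linarith) (fun y hy => ?_)
    · rw [newtonPotential_eq, ← key]
      congr 1 with y
      congr 2
      module
    · simp only [one_smul, zero_sub, norm_neg, zero_smul, sub_zero]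
      linarith [hR y hy]
  obtain ⟨R, hR⟩ := hinf
  refine ⟨?_, fun x hx => ?_⟩
  · refine HasCompactSupport.of_support_subset_isCompact (isCompact_closedBall (0 : V) R)
      fun x hx => ?_
    rw [mem_closedBall_zero_iff]
    by_contra h
    exact hx (hR x (not_le.1 h))
  · by_contra h
    exact notMem_tsupport_iff_eventuallyEq.2 (hloc x h) hx

theorem exists_laplacian_eq_of_orthogonal (hV : 2 ≤ Module.finrank ℝ V) {f : V → ℝ} {U : Set V}
    (hU : IsOpen U) (hf : ContDiff ℝ ∞ f) (hfc : HasCompactSupport f) (hfU : tsupport f ⊆ U)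
    (horth : ∀ u : V → ℝ, (∀ x ∈ U, ContDiffAt ℝ ∞ u x) → (∀ x ∈ U, (Δ u) x = 0) →
      ∫ x, f x * u x = 0) :
    ∃ φ : V → ℝ, ContDiff ℝ ∞ φ ∧ HasCompactSupport φ ∧ tsupport φ ⊆ U ∧ ∀ x, (Δ φ) x = f x := by
  have h2 : (2 : ℕ∞ω) ≤ ∞ := WithTop.coe_le_coe.2 (le_top : (2 : ℕ∞) ≤ ⊤)
  obtain ⟨c, hc, hfund⟩ := exists_integral_fundSol_mul_laplacian hV
  obtain ⟨hcs, hts⟩ := newtonPotential_compactSupport hU hf.continuous hfc hfU horth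
  have hsm := contDiff_newtonPotential hV hf hfc
  have hsm' : ContDiff ℝ ∞ (c⁻¹ • newtonPotential f) := hsm.const_smul c⁻¹
  refine ⟨c⁻¹ • newtonPotential f, hsm', hcs.smul_left (f := fun _ => c⁻¹),
    (tsupport_smul_subset_right (fun _ => c⁻¹) _).trans hts, fun x => ?_⟩
  have hg : ContDiff ℝ ∞ fun y => f (x - y) := hf.comp (contDiff_const.sub contDiff_id)
  have hgc : HasCompactSupport fun y => f (x - y) := hfc.comp_homeomorph (Homeomorph.subLeft x)
  rw [InnerProductSpace.laplacian_smul _ (hsm.of_le h2).contDiffAt,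
    laplacian_newtonPotential hV hf hfc, hfund _ hg hgc, sub_zero, smul_eq_mul,
    inv_mul_cancel_left₀ hc.ne']

end Orthogonal

/-! ### Local reproduction of harmonic functions -/

section Localization

theorem contDiff_mul_of_tsupport_subset {V : Type*} [NormedAddCommGroup V] [NormedSpace ℝ V]
    {χ u : V → ℝ} {U : Set V} (hχ : ContDiff ℝ ∞ χ)
    (hχU : tsupport χ ⊆ U) (hu : ∀ x ∈ U, ContDiffAt ℝ ∞ u x) :
    ContDiff ℝ ∞ fun x => χ x * u x := by
  refine contDiff_iff_contDiffAt.2 fun x => ?_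
  by_cases hx : x ∈ tsupport χ
  · exact hχ.contDiffAt.mul (hu x (hχU hx))
  · refine (contDiffAt_const (c := (0 : ℝ))).congr_of_eventuallyEq ?_
    filter_upwards [notMem_tsupport_iff_eventuallyEq.1 hx] with y hy
    simp [hy]

variable {V : Type*} [NormedAddCommGroup V] [InnerProductSpace ℝ V] [FiniteDimensional ℝ V]
  [MeasurableSpace V] [BorelSpace V]

/-- Near a compact subset of `U`, harmonic functions on `U` are reproduced by convolution with
a test function, after multiplication with a cutoff function. -/
theorem exists_cutoff_reproducing (hV : 2 ≤ Module.finrank ℝ V) {K U : Set V} (hK : IsCompact K)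
    (hU : IsOpen U) (hKU : K ⊆ U) :
    ∃ χ ρ : V → ℝ, ContDiff ℝ ∞ χ ∧ HasCompactSupport χ ∧ tsupport χ ⊆ U ∧
      ContDiff ℝ ∞ ρ ∧ HasCompactSupport ρ ∧
      ∀ u : V → ℝ, (∀ x ∈ U, ContDiffAt ℝ ∞ u x) → (∀ x ∈ U, (Δ u) x = 0) →
        ∀ x₀ ∈ K, u =ᶠ[nhds x₀] fun x => ∫ t, (χ t * u t) * ρ (x - t) := by
  obtain ⟨δ, hδ, hδU⟩ := hK.exists_cthickening_subset_open hU hKU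
  -- The cutoff is 1 near the 2δ/3-thickening of K: δ/3 for moving x away from K, and δ/3 for the
  -- support of ρ.
  obtain ⟨χ', hχ1, hχ0, -⟩ := exists_contMDiffMap_one_nhds_of_subset_interior
    (modelWithCornersSelf ℝ V) (n := ⊤) (s := Metric.cthickening (2 * δ / 3) K)
    (t := Metric.cthickening δ K) Metric.isClosed_cthickening
    ((Metric.cthickening_subset_thickening' hδ (by linarith) K).trans
      (interior_maximal (Metric.thickening_subset_cthickening δ K) Metric.isOpen_thickening))
  obtain ⟨ρ, hρ, hρs, hrep⟩ := exists_reproducing_kernel hV (by positivity : 0 < δ / 3)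
  let χ : V → ℝ := χ'
  have hχ : ContDiff ℝ ∞ χ := χ'.contMDiff.contDiff
  have hχs : tsupport χ ⊆ Metric.cthickening δ K :=
    closure_minimal (fun x hx => by by_contra h; exact hx (hχ0 x h)) Metric.isClosed_cthickening
  have hχc : HasCompactSupport χ := hK.cthickening.of_isClosed_subset (isClosed_tsupport _) hχs
  have hρc : HasCompactSupport ρ :=
    (isCompact_closedBall (0 : V) (δ / 3)).of_isClosed_subset (isClosed_tsupport _) hρs
  refine ⟨χ, ρ, hχ, hχc, hχs.trans hδU, hρ, hρc, fun u hu hu0 x₀ hx₀ => ?_⟩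
  have hw := contDiff_mul_of_tsupport_subset hχ (hχs.trans hδU) hu
  filter_upwards [Metric.ball_mem_nhds x₀ (by positivity : 0 < δ / 3)] with x hx
  have hnear : ∀ y ∈ Metric.closedBall x (δ / 3), y ∈ Metric.cthickening (2 * δ / 3) K := by
    intro y hy
    refine Metric.mem_cthickening_of_dist_le y x₀ _ K hx₀ ?_
    have := dist_triangle y x x₀
    rw [Metric.mem_closedBall] at hy
    rw [Metric.mem_ball] at hx
    linarith
  have hone : ∀ y ∈ Metric.closedBall x (δ / 3), (fun t => χ t * u t) =ᶠ[nhds y] u := by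
    intro y hy
    filter_upwards [hχ1.filter_mono (nhds_le_nhdsSet (hnear y hy))] with z hz
    simp only [χ, hz, one_mul]
  rw [hrep _ hw hχc.mul_right x fun y hy => ?_]
  · exact (hone x (Metric.mem_closedBall_self (by positivity))).eq_of_nhds.symm
  · rw [(InnerProductSpace.laplacian_congr_nhds (hone y hy)).eq_of_nhds]
    exact hu0 y (hδU (Metric.cthickening_mono (by linarith) K (hnear y hy)))

/-- A functional on harmonic functions on `U` which is represented by a continuous function with
compact support in `U` is also represented by a smooth one. -/
theorem exists_smooth_representative (hV : 2 ≤ Module.finrank ℝ V) {U : Set V} (hU : IsOpen U)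
    {f₀ : V → ℝ} (hf₀ : Continuous f₀) (hf₀c : HasCompactSupport f₀) (hf₀U : tsupport f₀ ⊆ U) :
    ∃ f : V → ℝ, ContDiff ℝ ∞ f ∧ HasCompactSupport f ∧ tsupport f ⊆ U ∧
      ∀ u : V → ℝ, (∀ x ∈ U, ContDiffAt ℝ ∞ u x) → (∀ x ∈ U, (Δ u) x = 0) →
        ∫ x, f₀ x * u x = ∫ x, f x * u x := by
  obtain ⟨χ, ρ, hχ, hχc, hχU, hρ, hρc, hrep⟩ := exists_cutoff_reproducing hV hf₀c hU hf₀U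
  let ρ' : V → ℝ := fun x => ρ (-x)
  have hρ' : ContDiff ℝ ∞ ρ' := hρ.comp contDiff_neg
  have hρ'c : HasCompactSupport ρ' := hρc.comp_homeomorph (Homeomorph.neg V)
  let h : V → ℝ := fun s => ∫ t, f₀ t * ρ' (s - t)
  have hh : ContDiff ℝ ∞ h := hρ'c.contDiff_convolution_right (ContinuousLinearMap.mul ℝ ℝ)
    hf₀.locallyIntegrable hρ'
  -- The convolution h of f₀ with the reflected kernel may leave U; the factor χ, already present in
  -- the reproducing formula, confines it.
  refine ⟨fun x => χ x * h x, hχ.mul hh, hχc.mul_right,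
    (tsupport_mul_subset_left).trans hχU, fun u hu hu0 => ?_⟩
  have hw := (contDiff_mul_of_tsupport_subset hχ hχU hu).continuous
  have e1 : ∀ x, f₀ x * u x = ∫ t, f₀ x * ((χ t * u t) * ρ (x - t)) := by
    intro x
    rw [integral_const_mul]
    by_cases hx : x ∈ tsupport f₀
    · rw [(hrep u hu hu0 x hx).eq_of_nhds]
    · simp [image_eq_zero_of_notMem_tsupport hx]
  simp only [e1]
  rw [integral_integral_swap_of_hasCompactSupport]
  · congr 1 with t
    simp only [h]
    rw [mul_right_comm, ← integral_const_mul]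
    congr 1 with x
    simp only [ρ', neg_sub]
    ring
  · have : Continuous fun z : V × V => f₀ z.1 * ((χ z.2 * u z.2) * ρ (z.1 - z.2)) :=
      (hf₀.comp continuous_fst).mul ((hw.comp continuous_snd).mul
        (hρ.continuous.comp (by fun_prop)))
    exact this
  · refine HasCompactSupport.intro (IsCompact.prod hf₀c hχc) fun z hz => ?_
    simp only [Function.uncurry]
    by_cases h1 : z.1 ∈ tsupport f₀
    · have h3 : z.2 ∉ tsupport χ := fun h => hz ⟨h1, h⟩
      simp [image_eq_zero_of_notMem_tsupport h3]
    · simp [image_eq_zero_of_notMem_tsupport h1]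

end Localization

/-! ### Continuous functionals and jets along a compact set -/

section Jets

variable {d : ℕ} {U : Opens (EuclideanSpace ℝ (Fin d))}

/-- The index set of the partial derivatives of order at most `m`. -/
abbrev JetIndex (d m : ℕ) : Type := Σ k : Fin (m + 1), (Fin k → Fin d)

/-- The restrictions to `K` of all partial derivatives of order at most `m` of `u`. -/
noncomputable def jetMap (K : Compacts U) (m : ℕ) :
    harmonicSubmodule U →ₗ[ℝ] (JetIndex d m → C(K, ℝ)) where
  toFun u a := ⟨fun x => SmoothFun.partialDeriv a.2 (u : SmoothFun U) x,
    (SmoothFun.continuous_partialDeriv a.2 (u : SmoothFun U)).comp continuous_subtype_val⟩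
  map_add' u v := by
    ext a x
    exact SmoothFun.partialDeriv_add a.2 (u : SmoothFun U) v x
  map_smul' c u := by
    ext a x
    exact SmoothFun.partialDeriv_smul a.2 c (u : SmoothFun U) x

theorem smoothSeminorm_le_norm_jetMap {K K' : Compacts U} {m m' : ℕ} (hK : K' ≤ K) (hm : m' ≤ m)
    (u : harmonicSubmodule U) :
    SmoothFun.smoothSeminorm K' m' (u : SmoothFun U) ≤ ‖jetMap K m u‖ := by
  refine Seminorm.finset_sup_apply_le (norm_nonneg _) fun k hk => ?_
  refine Seminorm.finset_sup_apply_le (norm_nonneg _) fun i _ => ?_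
  refine Real.iSup_le (fun x => ?_) (norm_nonneg _)
  have hk' : k < m + 1 := by
    have := Finset.mem_range.1 hk
    omega
  let a : JetIndex d m := ⟨⟨k, hk'⟩, i⟩
  have h1 : ‖jetMap K m u a‖ ≤ ‖jetMap K m u‖ := norm_le_pi_norm _ a
  have h2 := (jetMap K m u a).norm_coe_le_norm ⟨x, hK x.2⟩
  exact h2.trans h1

/-- Continuity bounds T by finitely many seminorms p_{K,m}; the union of the compacts and the
largest order dominate them all. -/
theorem exists_abs_le_norm_jetMap (T : HarmonicDual U) :
    ∃ (K : Compacts U) (m : ℕ) (C : ℝ), ∀ u, |T u| ≤ C * ‖jetMap K m u‖ := by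
  have hW := Topology.IsInducing.withSeminorms (SmoothFun.withSeminorms U)
    (f := (harmonicSubmodule U).subtype) Topology.IsInducing.subtypeVal
  obtain ⟨s, C, -, hC⟩ := Seminorm.bound_of_continuous hW
    ((normSeminorm ℝ ℝ).comp (T : harmonicSubmodule U →ₗ[ℝ] ℝ)) T.continuous.norm
  refine ⟨s.sup Prod.fst, s.sup Prod.snd, C, fun u => (hC u).trans ?_⟩
  refine mul_le_mul_of_nonneg_left ?_ C.2
  refine Seminorm.finset_sup_apply_le (norm_nonneg _) fun p hp => ?_
  exact smoothSeminorm_le_norm_jetMap (Finset.le_sup (f := Prod.fst) hp)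
    (Finset.le_sup (f := Prod.snd) hp) u

/-- A functional that is dominated by the norm of a linear map factors through that map. -/
theorem exists_strongDual_comp_eq {H X : Type*} [AddCommGroup H] [Module ℝ H]
    [NormedAddCommGroup X] [NormedSpace ℝ X] (J : H →ₗ[ℝ] X) (T : H →ₗ[ℝ] ℝ) (C : ℝ)
    (hT : ∀ u, |T u| ≤ C * ‖J u‖) : ∃ S : X →L[ℝ] ℝ, ∀ u, S (J u) = T u := by
  have hker : LinearMap.ker J ≤ LinearMap.ker T := fun u hu => by
    have := hT u
    rw [LinearMap.mem_ker.1 hu, norm_zero, mul_zero] at this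
    exact LinearMap.mem_ker.2 (abs_nonpos_iff.1 this)
  let S₀ : LinearMap.range J →ₗ[ℝ] ℝ :=
    (LinearMap.ker J).liftQ T hker ∘ₗ J.quotKerEquivRange.symm.toLinearMap
  have hS₀ : ∀ u, S₀ ⟨J u, LinearMap.mem_range_self J u⟩ = T u := by
    intro u
    have : J.quotKerEquivRange.symm ⟨J u, LinearMap.mem_range_self J u⟩ =
        (LinearMap.ker J).mkQ u := by
      rw [LinearEquiv.symm_apply_eq]
      rfl
    simp [S₀, this]
  obtain ⟨S, hS, -⟩ := exists_extension_norm_eq (LinearMap.range J)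
    (S₀.mkContinuous C (by
      rintro ⟨_, u, rfl⟩
      rw [hS₀]
      exact hT u))
  refine ⟨S, fun u => ?_⟩
  rw [hS ⟨J u, LinearMap.mem_range_self J u⟩]
  exact hS₀ u

/-- The jet along `K` of the translate of `ρ` by `t`. -/
noncomputable def translateJet (K : Compacts U) (m : ℕ) {ρ : EuclideanSpace ℝ (Fin d) → ℝ}
    (hρ : ContDiff ℝ ∞ ρ) (t : EuclideanSpace ℝ (Fin d)) : JetIndex d m → C(K, ℝ) := fun a =>
  ⟨fun x => iteratedFDeriv ℝ a.1 ρ ((x : U) - t) fun j => EuclideanSpace.single (a.2 j) 1,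
    (contDiff_iteratedFDeriv_apply hρ a.1 _).continuous.comp (by fun_prop)⟩

theorem continuous_translateJet (K : Compacts U) (m : ℕ) {ρ : EuclideanSpace ℝ (Fin d) → ℝ}
    (hρ : ContDiff ℝ ∞ ρ) : Continuous (translateJet K m hρ) := by
  refine continuous_pi fun a => ?_
  refine ContinuousMap.continuous_of_continuous_uncurry _ ?_
  have h := (contDiff_iteratedFDeriv_apply hρ a.1
    fun j => EuclideanSpace.single (a.2 j) (1 : ℝ)).continuous
  exact h.comp (f := fun z : EuclideanSpace ℝ (Fin d) × K =>
    ((z.2 : U) : EuclideanSpace ℝ (Fin d)) - z.1) (by fun_prop)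

theorem exists_continuous_representative (hd : 2 ≤ d) (T : HarmonicDual U) :
    ∃ f : EuclideanSpace ℝ (Fin d) → ℝ, Continuous f ∧ HasCompactSupport f ∧ tsupport f ⊆ U ∧
      ∀ u : harmonicSubmodule U, T u = ∫ x, f x * (u : SmoothFun U).ext x := by
  obtain ⟨K, m, C, hC⟩ := exists_abs_le_norm_jetMap T
  obtain ⟨S, hS⟩ := exists_strongDual_comp_eq (jetMap K m) (T : harmonicSubmodule U →ₗ[ℝ] ℝ) C hC
  have hK : IsCompact (Subtype.val '' (K : Set U)) := K.isCompact.image continuous_subtype_val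
  obtain ⟨χ, ρ, hχ, hχc, hχU, hρ, hρc, hrep⟩ := exists_cutoff_reproducing
    (by simpa using hd) hK U.isOpen (by rintro _ ⟨x, -, rfl⟩; exact x.2)
  have hR := continuous_translateJet K m hρ
  -- Translates of ρ need not be harmonic on U, so T itself cannot be applied to them; its
  -- Hahn–Banach extension S to all jets can.
  refine ⟨fun t => χ t * S (translateJet K m hρ t), hχ.continuous.mul (S.continuous.comp hR),
    hχc.mul_right, (tsupport_mul_subset_left).trans hχU, fun u => ?_⟩
  have hu : ∀ x ∈ U, ContDiffAt ℝ ∞ (u : SmoothFun U).ext x :=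
    fun x hx => (u : SmoothFun U).contDiffAt hx
  have hw : Continuous fun t => χ t * (u : SmoothFun U).ext t :=
    (contDiff_mul_of_tsupport_subset hχ hχU hu).continuous
  have hint : Integrable fun t => (χ t * (u : SmoothFun U).ext t) • translateJet K m hρ t :=
    (hw.smul hR).integrable_of_hasCompactSupport
      ((hχc.mul_right (f' := (u : SmoothFun U).ext)).smul_right)
  have hJ : jetMap K m u = ∫ t, (χ t * (u : SmoothFun U).ext t) • translateJet K m hρ t := by
    ext a x
    let ev : (JetIndex d m → C(K, ℝ)) →L[ℝ] ℝ :=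
      (ContinuousMap.evalCLM ℝ x).comp (ContinuousLinearMap.proj a)
    have hev : ev (∫ t, (χ t * (u : SmoothFun U).ext t) • translateJet K m hρ t) =
        ∫ t, ev ((χ t * (u : SmoothFun U).ext t) • translateJet K m hρ t) :=
      (ev.integral_comp_comm hint).symm
    refine Eq.trans ?_ hev.symm
    have hx := hrep _ hu u.2 (x : U) ⟨x, x.2, rfl⟩
    -- Reproduction holds for germs at x, not only for values on K, so it passes to derivatives.
    have e := (hx.iteratedFDeriv ℝ (a.1 : ℕ)).eq_of_nhds
    change iteratedFDeriv ℝ a.1 (u : SmoothFun U).ext (x : U) _ = _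
    rw [e, iteratedFDeriv_convolution_apply hw.locallyIntegrable hρ hρc]
    rfl
  change T u = _
  rw [show T u = S (jetMap K m u) from (hS u).symm, hJ, ← S.integral_comp_comm hint]
  congr 1 with t
  rw [map_smul, smul_eq_mul]
  ring

end Jets

/-! ### The pairing map: continuity, kernel and surjectivity -/

section Pairing

variable {d : ℕ} {U : Opens (EuclideanSpace ℝ (Fin d))}

theorem testLaplacian_apply (φ : 𝓓(U, ℝ)) (x : EuclideanSpace ℝ (Fin d)) :
    testLaplacian U φ x = -(Δ (φ : EuclideanSpace ℝ (Fin d) → ℝ)) x := by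
  let b := stdOrthonormalBasis ℝ (EuclideanSpace ℝ (Fin d))
  have h2 : (2 : ℕ∞ω) ≤ ∞ := WithTop.coe_le_coe.2 (le_top : (2 : ℕ∞) ≤ ⊤)
  have hD : ∀ (ψ : 𝓓(U, ℝ)) v, (LineDeriv.lineDerivOp v ψ : 𝓓(U, ℝ)) =
      dirDeriv v (ψ : EuclideanSpace ℝ (Fin d) → ℝ) := by
    intro ψ v
    ext y
    rw [TestFunction.lineDerivOp_eq_lineDerivCLM ℝ, TestFunction.lineDerivCLM_apply_of_le (by simp)]
    exact (ψ.contDiff.contDiffAt.differentiableAt (by simp)).lineDeriv_eq_fderiv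
  have e : testLaplacian U φ =
      -∑ i, LineDeriv.lineDerivOp (b i) (LineDeriv.lineDerivOp (b i) φ : 𝓓(U, ℝ)) := by
    rw [← LineDeriv.laplacianCLM_eq_sum b φ]
    rfl
  let ev : 𝓓(U, ℝ) →+ ℝ := ⟨⟨fun ψ => ψ x, rfl⟩, fun _ _ => rfl⟩
  rw [e, laplacian_eq_sum_dirDeriv b (φ.contDiff.of_le h2).contDiffAt]
  change -(ev (∑ i, LineDeriv.lineDerivOp (b i) (LineDeriv.lineDerivOp (b i) φ : 𝓓(U, ℝ)))) = _
  rw [map_sum]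
  refine congrArg _ (Finset.sum_congr rfl fun i _ => ?_)
  change (LineDeriv.lineDerivOp (b i) (LineDeriv.lineDerivOp (b i) φ : 𝓓(U, ℝ)) : 𝓓(U, ℝ)) x = _
  rw [hD, hD]

theorem harmonicPairing_eq_integral (f : 𝓓(U, ℝ)) (u : harmonicSubmodule U) :
    harmonicPairing f u = ∫ x, f x * (u : SmoothFun U).ext x := by
  refine setIntegral_eq_integral_of_forall_compl_eq_zero fun x hx => ?_
  rw [image_eq_zero_of_notMem_tsupport fun h => hx (f.tsupport_subset h), zero_mul]

theorem contDiff_testFunction_mul (f : 𝓓(U, ℝ)) (u : SmoothFun U) :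
    ContDiff ℝ ∞ fun x => f x * u.ext x :=
  contDiff_mul_of_tsupport_subset f.contDiff f.tsupport_subset fun _ hx => u.contDiffAt hx

theorem integrable_testFunction_mul (f : 𝓓(U, ℝ)) (u : SmoothFun U) :
    Integrable fun x => f x * u.ext x :=
  (contDiff_testFunction_mul f u).continuous.integrable_of_hasCompactSupport
    f.hasCompactSupport.mul_right

theorem harmonicPairing_testLaplacian (φ : 𝓓(U, ℝ)) (u : harmonicSubmodule U) :
    harmonicPairing (testLaplacian U φ) u = 0 := by
  have h2 : (2 : ℕ∞ω) ≤ ∞ := WithTop.coe_le_coe.2 (le_top : (2 : ℕ∞) ≤ ⊤)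
  -- Green's formula is for functions smooth on the whole space, so u is first cut off by a χ that
  -- is 1 near the support of φ.
  obtain ⟨χ, hχ, hχU, hχ1⟩ : ∃ χ : EuclideanSpace ℝ (Fin d) → ℝ, ContDiff ℝ ∞ χ ∧
      tsupport χ ⊆ U ∧ ∀ x ∈ tsupport φ, ∀ᶠ y in nhds x, χ y = 1 := by
    obtain ⟨δ, hδ, hδU⟩ :=
      φ.hasCompactSupport.isCompact.exists_cthickening_subset_open U.isOpen φ.tsupport_subset
    obtain ⟨χ, hχ1, hχ0, -⟩ := exists_contMDiffMap_one_nhds_of_subset_interior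
      (modelWithCornersSelf ℝ (EuclideanSpace ℝ (Fin d))) (n := ⊤)
      (s := tsupport φ) (t := Metric.cthickening δ (tsupport φ)) (isClosed_tsupport _)
      ((Metric.self_subset_thickening hδ _).trans (interior_maximal
        (Metric.thickening_subset_cthickening δ _) Metric.isOpen_thickening))
    exact ⟨χ, χ.contMDiff.contDiff, (closure_minimal (fun x hx => by
      by_contra h; exact hx (hχ0 x h)) Metric.isClosed_cthickening).trans hδU,
      fun x hx => hχ1.filter_mono (nhds_le_nhdsSet hx)⟩
  have hw : ContDiff ℝ ∞ fun x => χ x * (u : SmoothFun U).ext x :=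
    contDiff_mul_of_tsupport_subset hχ hχU fun _ hx => (u : SmoothFun U).contDiffAt hx
  have green := integral_mul_laplacian (hw.of_le h2) (φ.contDiff.of_le h2) φ.hasCompactSupport
  have hloc : ∀ x ∈ tsupport φ,
      (fun y => χ y * (u : SmoothFun U).ext y) =ᶠ[nhds x] (u : SmoothFun U).ext := by
    intro x hx
    filter_upwards [hχ1 x hx] with y hy
    rw [hy, one_mul]
  have hright : ∀ x, (Δ fun y => χ y * (u : SmoothFun U).ext y) x * φ x = 0 := by
    intro x
    by_cases hx : x ∈ tsupport φ
    · rw [(InnerProductSpace.laplacian_congr_nhds (hloc x hx)).eq_of_nhds,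
        u.2 x (φ.tsupport_subset hx), zero_mul]
    · rw [image_eq_zero_of_notMem_tsupport hx, mul_zero]
  simp only [hright, integral_zero] at green
  rw [harmonicPairing_eq_integral, ← neg_eq_zero, ← integral_neg, ← green]
  congr 1 with x
  rw [testLaplacian_apply]
  by_cases hx : x ∈ tsupport φ
  · rw [(hχ1 x hx).self_of_nhds]
    ring
  · rw [image_eq_zero_of_notMem_tsupport fun h => hx (tsupport_laplacian_subset _ h)]
    ring

theorem abs_harmonicPairing_le (f : 𝓓(U, ℝ)) : ∃ (K : Compacts U) (C : NNReal),
    ∀ u : harmonicSubmodule U,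
      |harmonicPairing f u| ≤ C * SmoothFun.smoothSeminorm K 0 (u : SmoothFun U) := by
  let K : Compacts U := ⟨Subtype.val ⁻¹' tsupport f,
    Topology.IsInducing.subtypeVal.isCompact_preimage' f.hasCompactSupport.isCompact (by
      rw [Subtype.range_coe]; exact f.tsupport_subset)⟩
  have hfi : Integrable fun x => |f x| :=
    (f.continuous.integrable_of_hasCompactSupport f.hasCompactSupport).abs
  refine ⟨K, ⟨∫ x, |f x|, integral_nonneg fun _ => abs_nonneg _⟩, fun u => ?_⟩
  have hpt : ∀ x, |f x * (u : SmoothFun U).ext x| ≤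
      |f x| * SmoothFun.smoothSeminorm K 0 (u : SmoothFun U) := by
    intro x
    rw [abs_mul]
    by_cases hx : x ∈ tsupport f
    · refine mul_le_mul_of_nonneg_left ?_ (abs_nonneg _)
      let y : U := ⟨x, f.tsupport_subset hx⟩
      let i : Fin 0 → Fin d := Fin.elim0
      have h1 : |(u : SmoothFun U).ext x| ≤
          SmoothFun.partialSeminorm K i (u : SmoothFun U) := by
        have := le_ciSup (SmoothFun.bddAbove_partialDeriv K i (u : SmoothFun U)) ⟨y, hx⟩
        simp only [SmoothFun.partialDeriv, iteratedFDeriv_zero_apply] at this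
        exact this
      have h2 : SmoothFun.partialSeminorm K i ≤
          (Finset.univ.sup fun i : Fin 0 → Fin d => SmoothFun.partialSeminorm K i) :=
        Finset.le_sup (f := fun i : Fin 0 → Fin d => SmoothFun.partialSeminorm K i)
          (Finset.mem_univ i)
      have h3 := h2.trans (Finset.le_sup (f := fun k => Finset.univ.sup
        fun i : Fin k → Fin d => SmoothFun.partialSeminorm K i)
        (Finset.mem_range.2 (Nat.lt_succ_self 0)))
      exact h1.trans (h3 _)
    · simp [image_eq_zero_of_notMem_tsupport hx]
  rw [harmonicPairing_eq_integral]
  calc |∫ x, f x * (u : SmoothFun U).ext x| ≤ ∫ x, |f x * (u : SmoothFun U).ext x| :=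
        abs_integral_le_integral_abs
    _ ≤ ∫ x, |f x| * SmoothFun.smoothSeminorm K 0 (u : SmoothFun U) :=
        integral_mono (integrable_testFunction_mul f _).abs (hfi.mul_const _) hpt
    _ = _ := by rw [integral_mul_const]; rfl

/-- The functional `u ↦ B(f, u)` as a linear map. -/
noncomputable def pairingLinear (f : 𝓓(U, ℝ)) : harmonicSubmodule U →ₗ[ℝ] ℝ where
  toFun u := harmonicPairing f u
  map_add' u v := by
    simp only [harmonicPairing_eq_integral]
    rw [← integral_add (integrable_testFunction_mul f _) (integrable_testFunction_mul f _)]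
    congr 1 with x
    rw [← mul_add]
    exact congrArg (f x * ·) (congrFun (SmoothFun.ext_add (u : SmoothFun U) v) x)
  map_smul' c u := by
    simp only [harmonicPairing_eq_integral, RingHom.id_apply, smul_eq_mul]
    rw [← integral_const_mul]
    congr 1 with x
    rw [mul_left_comm]
    exact congrArg (f x * ·) (congrFun (SmoothFun.ext_smul c (u : SmoothFun U)) x)

theorem continuous_pairingLinear (f : 𝓓(U, ℝ)) : Continuous (pairingLinear f) := by
  obtain ⟨K, C, hC⟩ := abs_harmonicPairing_le f
  have hW := Topology.IsInducing.withSeminorms (SmoothFun.withSeminorms U)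
    (f := (harmonicSubmodule U).subtype) Topology.IsInducing.subtypeVal
  refine WithSeminorms.continuous_normedSpace_rng ℝ hW (pairingLinear f) ⟨{(K, 0)}, C, fun u => ?_⟩
  rw [Finset.sup_singleton]
  exact hC u

/-- The functional `u ↦ B(f, u)`. -/
noncomputable def pairingFunctional (f : 𝓓(U, ℝ)) : HarmonicDual U :=
  ⟨pairingLinear f, continuous_pairingLinear f⟩

/-- The linear map `f ↦ B(f, ·)`. -/
noncomputable def pairingMap (U : Opens (EuclideanSpace ℝ (Fin d))) :
    𝓓(U, ℝ) →ₗ[ℝ] HarmonicDual U where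
  toFun := pairingFunctional
  map_add' f g := by
    ext u
    change harmonicPairing (f + g) u = harmonicPairing f u + harmonicPairing g u
    simp only [harmonicPairing_eq_integral]
    rw [← integral_add (integrable_testFunction_mul f _) (integrable_testFunction_mul g _)]
    congr 1 with x
    exact add_mul _ _ _
  map_smul' c f := by
    ext u
    change harmonicPairing (c • f) u = c * harmonicPairing f u
    simp only [harmonicPairing_eq_integral]
    rw [← integral_const_mul]
    congr 1 with x
    exact mul_assoc _ _ _

theorem pairingMap_apply (f : 𝓓(U, ℝ)) (u : harmonicSubmodule U) :
    pairingMap U f u = harmonicPairing f u :=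
  rfl

theorem zeroExtend_restrict_eventuallyEq (u : EuclideanSpace ℝ (Fin d) → ℝ)
    {x : EuclideanSpace ℝ (Fin d)} (hx : x ∈ U) :
    zeroExtend (fun y : U => u y) =ᶠ[nhds x] u := by
  filter_upwards [U.isOpen.mem_nhds hx] with y hy
  exact zeroExtend_apply (fun y : U => u y) ⟨y, hy⟩

/-- The restriction to `U` of a function which is smooth and harmonic at every point of `U`. -/
def harmonicRestrict (u : EuclideanSpace ℝ (Fin d) → ℝ) (hu : ∀ x ∈ U, ContDiffAt ℝ ∞ u x)
    (hu0 : ∀ x ∈ U, (Δ u) x = 0) : harmonicSubmodule U :=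
  ⟨⟨fun y => u y, fun x hx =>
      ((hu x hx).congr_of_eventuallyEq (zeroExtend_restrict_eventuallyEq u hx)).contDiffWithinAt⟩,
    fun x hx => (InnerProductSpace.laplacian_congr_nhds
      (zeroExtend_restrict_eventuallyEq u hx)).eq_of_nhds.trans (hu0 x hx)⟩

theorem ker_pairingMap (hd : 2 ≤ d) : LinearMap.ker (pairingMap U) = laplacianRange U := by
  refine le_antisymm (fun f hf => ?_) ?_
  · have horth : ∀ u : EuclideanSpace ℝ (Fin d) → ℝ, (∀ x ∈ U, ContDiffAt ℝ ∞ u x) →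
        (∀ x ∈ U, (Δ u) x = 0) → ∫ x, f x * u x = 0 := by
      intro u hu hu0
      have h := DFunLike.congr_fun (LinearMap.mem_ker.1 hf) (harmonicRestrict u hu hu0)
      rw [pairingMap_apply, harmonicPairing_eq_integral] at h
      refine Eq.trans ?_ h
      congr 1 with x
      by_cases hx : x ∈ tsupport f
      · exact congrArg (f x * ·)
          (zeroExtend_restrict_eventuallyEq u (f.tsupport_subset hx)).eq_of_nhds.symm
      · simp [image_eq_zero_of_notMem_tsupport hx]
    obtain ⟨φ, hφ, hφc, hφU, hφΔ⟩ := exists_laplacian_eq_of_orthogonal (by simpa using hd)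
      U.isOpen f.contDiff f.hasCompactSupport f.tsupport_subset horth
    let Φ : 𝓓(U, ℝ) := ⟨φ, hφ, hφc, hφU⟩
    -- The sign reflects that `testLaplacian` is minus the Laplacian solved for by φ.
    refine ⟨-Φ, ?_⟩
    rw [map_neg]
    ext x
    change -(testLaplacian U Φ x) = f x
    rw [testLaplacian_apply, neg_neg]
    exact hφΔ x
  · rintro _ ⟨φ, rfl⟩
    refine LinearMap.mem_ker.2 ?_
    ext u
    exact harmonicPairing_testLaplacian φ u

theorem pairingMap_surjective (hd : 2 ≤ d) : Function.Surjective (pairingMap U) := by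
  intro T
  obtain ⟨f₀, hf₀, hf₀c, hf₀U, hT⟩ := exists_continuous_representative hd T
  obtain ⟨f, hf, hfc, hfU, hrep⟩ :=
    exists_smooth_representative (by simpa using hd) U.isOpen hf₀ hf₀c hf₀U
  refine ⟨⟨f, hf, hfc, hfU⟩, ?_⟩
  ext u
  rw [pairingMap_apply, harmonicPairing_eq_integral, hT u,
    hrep _ (fun x hx => (u : SmoothFun U).contDiffAt hx) u.2]
  rfl

theorem harmonicPairing_one (f : 𝓓(U, ℝ)) : harmonicPairing f (harmonicOne U) = ∫ x, f x := by
  rw [harmonicPairing_eq_integral]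
  congr 1 with x
  by_cases hx : x ∈ tsupport f
  · have : ((harmonicOne U : harmonicSubmodule U) : SmoothFun U).ext x = 1 :=
      (zeroExtend_one_eventuallyEq (f.tsupport_subset hx)).eq_of_nhds
    rw [this, mul_one]
  · simp [image_eq_zero_of_notMem_tsupport hx]

theorem comap_harmonicDualZero : (harmonicDualZero U).comap (pairingMap U) = meanZeroTest U := by
  ext f
  change harmonicPairing f (harmonicOne U) = 0 ↔ ∫ x, f x = 0
  rw [harmonicPairing_one]

end Pairing

/-! ### Passage to quotients -/

section Quotient

variable {M N : Type*} [AddCommGroup M] [Module ℝ M] [AddCommGroup N] [Module ℝ N]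

theorem exists_quotient_equiv (P : M →ₗ[ℝ] N) {p : Submodule ℝ M} (hker : LinearMap.ker P = p)
    (hP : Function.Surjective P) :
    ∃ e : (M ⧸ p) ≃ₗ[ℝ] N, ∀ m, e (Submodule.Quotient.mk m) = P m := by
  subst hker
  exact ⟨P.quotKerEquivOfSurjective hP, fun m => rfl⟩

/-- Because M₀ is the full preimage of N₀, the restriction of P to M₀ still maps onto N₀, and its
kernel is the trace of p on M₀. -/
theorem exists_quotient_equiv_restrict (P : M →ₗ[ℝ] N) {p M₀ : Submodule ℝ M} {N₀ : Submodule ℝ N}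
    (hker : LinearMap.ker P = p) (hP : Function.Surjective P) (hM₀ : N₀.comap P = M₀) :
    ∃ e : (M₀ ⧸ p.comap M₀.subtype) ≃ₗ[ℝ] N₀,
      ∀ m : M₀, (e (Submodule.Quotient.mk m) : N) = P m := by
  subst hM₀
  let P₀ : N₀.comap P →ₗ[ℝ] N₀ := P.restrict fun _ hm => hm
  obtain ⟨e, he⟩ := exists_quotient_equiv P₀ (p := p.comap (N₀.comap P).subtype)
    (by
      rw [← hker]
      ext m
      exact Subtype.ext_iff)
    (by
      rintro ⟨n, hn⟩
      obtain ⟨m, rfl⟩ := hP n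
      exact ⟨⟨m, hn⟩, rfl⟩)
  exact ⟨e, fun m => by rw [he]; rfl⟩

end Quotient

theorem mainTheorem2 (d : ℕ) (hd : 2 ≤ d) (U : TopologicalSpace.Opens (EuclideanSpace ℝ (Fin d))) :
    ∃ T : (𝓓(U, ℝ) ⧸ laplacianRange U) ≃ₗ[ℝ] HarmonicDual U,
      (∀ (f : 𝓓(U, ℝ)) (u : harmonicSubmodule U),
        T (Submodule.Quotient.mk f) u = harmonicPairing f u) ∧
      laplacianRange U ≤ meanZeroTest U ∧
      ∃ T₀ : (meanZeroTest U ⧸ (laplacianRange U).comap (meanZeroTest U).subtype) ≃ₗ[ℝ]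
          harmonicDualZero U,
        ∀ f : meanZeroTest U,
          (T₀ (Submodule.Quotient.mk f) : HarmonicDual U) =
            T (Submodule.Quotient.mk (f : 𝓓(U, ℝ))) := by
  obtain ⟨T, hT⟩ := exists_quotient_equiv (pairingMap U) (ker_pairingMap hd)
    (pairingMap_surjective hd)
  obtain ⟨T₀, hT₀⟩ := exists_quotient_equiv_restrict (pairingMap U) (ker_pairingMap hd)
    (pairingMap_surjective hd) comap_harmonicDualZero
  refine ⟨T, fun f u => ?_, ?_, T₀, fun f => ?_⟩
  · rw [hT, pairingMap_apply]
  · rw [← ker_pairingMap hd, ← comap_harmonicDualZero]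
    intro f hf
    rw [Submodule.mem_comap, LinearMap.mem_ker.1 hf]
    exact Submodule.zero_mem _
  · rw [hT₀, hT]
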